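/- Let $d\ge 2$ and let $P=\mathbb C[\partial_0,\dots,\partial_{d-1}]$ be the ring of linear differential operators with constant coefficients on $X=\mathbb R^d$. A system is a matrix $T\in P^{n\times m}$ ($n,m\ge 0$), read as the system of equations $\sum_{i}T_{ai}\phi^i=0$, $a=1,\dots,n$, for $\phi\in C^\infty(X,\mathbb C)^m$. Let $\Sigma$ be the space of all its smooth solutions. A vector $R\in P^m$ is a gauge symmetry of $T$ if $R\varepsilon=(R^1\varepsilon,\dots,R^m\varepsilon)\in\Sigma$ for every $\varepsilon\in C^\infty(X,\mathbb C)$, and $\Sigma'\subseteq\Sigma$ is the linear span of all such $R\varepsilon$ (the trivial solutions). For a space $S$ of smooth vector functions put $h_S(N)=\dim p_N(S)-\dim p_{N-1}(S)$, where $p_N$ takes $\phi$ to its Taylor polynomial at $0$ of degree at most $N$ (and $p_{-1}=0$). The degree of freedom of the system is $$\mathcal N_T=\frac1{d-1}\lim_{N\to\infty}N\,\frac{h_\Sigma(N)-h_{\Sigma'}(N)}{\binom{N+d-1}{N}} .$$ The conjugate of $T$ is the $m\times n$ matrix $T^\dagger$ with $T^\dagger_{ia}(\partial)=T_{ai}(-\partial)$,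 and $T^*$ denotes the transpose of $T$. Systems $T\in P^{n\times m}$ and $T'\in P^{n'\times m}$ in the same fields are equivalent if $T'=DT$ and $T=D'T'$ for some matrices $D,D'$ over $P$. Two systems are elementary equivalent if they are equivalent or their conjugates are equivalent, and weakly equivalent if they are joined by a finite chain of elementary equivalences. (1) If $T$ and $T'$ are equivalent, then $\mathcal N_T=\mathcal N_{T'}$, $\mathcal N_{T^\dagger}=\mathcal N_{T'^\dagger}$ and $\mathcal N_{T^*}=\mathcal N_{T'^*}$. (2) If $T$ and $T'$ are weakly equivalent, then $\mathcal N_T=\mathcal N_{T'}$, $\mathcal N_{T^\dagger}=\mathcal N_{T'^\dagger}$ and $\mathcal N_{T^*}=\mathcal N_{T'^*}$. Each of these equalities includes the assertion that both limits exist and are finite. -/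

import Mathlib

open scoped ContDiff
open Filter Topology

noncomputable section

namespace LinearPDE

/-- Space-time: a `d`-dimensional real linear space with linear coordinates `x^0, …, x^(d-1)`. -/
abbrev Spacetime (d : ℕ) : Type := Fin d → ℝ

/-- The ring `P = ℂ[∂_0, …, ∂_(d-1)]` of differential operators with constant coefficients. -/
abbrev DiffPoly (d : ℕ) : Type := MvPolynomial (Fin d) ℂ

/-- The complex vector space of smooth complex-valued functions on space-time. -/
def Smooth (d : ℕ) : Submodule ℂ (Spacetime d → ℂ) where
  carrier := {f | ContDiff ℝ ∞ f}
  add_mem' {f g} hf hg := by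
    have hf' : ContDiff ℝ ∞ f := hf
    have hg' : ContDiff ℝ ∞ g := hg
    exact hf'.add hg'
  zero_mem' := by
    have h : ContDiff ℝ ∞ (fun _ : Spacetime d => (0 : ℂ)) := contDiff_const
    exact h
  smul_mem' c f hf := by
    have hf' : ContDiff ℝ ∞ f := hf
    exact hf'.const_smul c

theorem contDiff_smooth {d : ℕ} (f : Smooth d) : ContDiff ℝ ∞ (f : Spacetime d → ℂ) := f.2

theorem differentiable_smooth {d : ℕ} (f : Smooth d) :
    Differentiable ℝ (f : Spacetime d → ℂ) :=
  (contDiff_smooth f).differentiable (by simp)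

/-- The partial derivative `∂_μ = ∂/∂x^μ` on smooth functions. -/
def partialDeriv {d : ℕ} (μ : Fin d) : Module.End ℂ (Smooth d) where
  toFun f := ⟨fun x => fderiv ℝ (f : Spacetime d → ℂ) x (Pi.single μ 1),
    ((contDiff_smooth f).fderiv_right (m := ∞) (by simp)).clm_apply contDiff_const⟩
  map_add' f g := by
    ext x
    change fderiv ℝ ((f : Spacetime d → ℂ) + (g : Spacetime d → ℂ)) x _ = _
    rw [fderiv_add (differentiable_smooth f x) (differentiable_smooth g x)]
    rfl
  map_smul' c f := by
    ext x
    change fderiv ℝ (c • (f : Spacetime d → ℂ)) x _ = _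
    rw [fderiv_const_smul (differentiable_smooth f x)]
    rfl

/-- The iterated derivative `∂^α = ∂_0^(α_0) ⋯ ∂_(d-1)^(α_(d-1))`. -/
def multiDeriv {d : ℕ} (α : Fin d →₀ ℕ) : Module.End ℂ (Smooth d) :=
  ((List.finRange d).map fun μ => partialDeriv μ ^ α μ).prod

/-- The differential operator `p(∂)` acting on smooth functions. -/
def diffOp {d : ℕ} (p : DiffPoly d) : Module.End ℂ (Smooth d) :=
  ∑ α ∈ p.support, p.coeff α • multiDeriv α

/-- The matrix differential operator `T`, with entries in `P`, acting on `m`-tuples of smooth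
functions: `(T φ)_a = ∑_i T_{ai} φ^i`. -/
def matrixOp {d n m : ℕ} (T : Matrix (Fin n) (Fin m) (DiffPoly d)) :
    (Fin m → Smooth d) →ₗ[ℂ] (Fin n → Smooth d) :=
  LinearMap.pi fun a => ∑ i, diffOp (T a i) ∘ₗ LinearMap.proj i

/-- The mass shell `Σ` of the system `T φ = 0`: all its smooth solutions. -/
def solutions {d n m : ℕ} (T : Matrix (Fin n) (Fin m) (DiffPoly d)) :
    Submodule ℂ (Fin m → Smooth d) :=
  LinearMap.ker (matrixOp T)

/-- The gauge transformation `φ^i = R^i ε` with generator `R` and parameter `ε`. -/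
def gaugeTransform {d m : ℕ} (R : Fin m → DiffPoly d) (ε : Smooth d) : Fin m → Smooth d :=
  fun i => diffOp (R i) ε

/-- `R` generates a gauge symmetry of the system `T φ = 0`: the field `R ε` is a solution for every
smooth gauge parameter `ε`. -/
def IsGaugeSymmetry {d n m : ℕ} (T : Matrix (Fin n) (Fin m) (DiffPoly d))
    (R : Fin m → DiffPoly d) : Prop :=
  ∀ ε : Smooth d, gaugeTransform R ε ∈ solutions T

/-- The space `Σ'` of trivial solutions: linear combinations of gauge transformations. -/
def trivialSolutions {d n m : ℕ} (T : Matrix (Fin n) (Fin m) (DiffPoly d)) :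
    Submodule ℂ (Fin m → Smooth d) :=
  Submodule.span ℂ {φ | ∃ R, IsGaugeSymmetry T R ∧ ∃ ε, φ = gaugeTransform R ε}

/-- The Taylor coefficient `f_α = (∂^α f)(0) / α!`. -/
def taylorCoeff {d : ℕ} (α : Fin d →₀ ℕ) : Smooth d →ₗ[ℂ] ℂ :=
  ((∏ μ, (α μ).factorial : ℕ) : ℂ)⁻¹ •
    (LinearMap.proj (0 : Spacetime d) ∘ₗ (Smooth d).subtype ∘ₗ multiDeriv α)

/-- The projection `p_N`: the Taylor polynomial `∑_{|α| ≤ N} f_α x^α` of each component. -/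
def taylorProj {d : ℕ} (m N : ℕ) :
    (Fin m → Smooth d) →ₗ[ℂ] (Fin m → MvPolynomial (Fin d) ℂ) :=
  LinearMap.pi fun i =>
    (∑ k ∈ Finset.range (N + 1), ∑ α ∈ (Finset.univ : Finset (Fin d)).finsuppAntidiag k,
      MvPolynomial.monomial α ∘ₗ taylorCoeff α) ∘ₗ LinearMap.proj i

/-- The Hilbert function `h_S(N) = dim p_N(S) - dim p_(N-1)(S)`, with `p_(-1) = 0`. -/
def hilbertFun {d m : ℕ} (S : Submodule ℂ (Fin m → Smooth d)) : ℕ → ℤ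
  | 0 => Module.finrank ℂ (S.map (taylorProj m 0))
  | N + 1 => (Module.finrank ℂ (S.map (taylorProj m (N + 1))) : ℤ)
      - Module.finrank ℂ (S.map (taylorProj m N))

/-- `c` is the physical degree of freedom of the system `T φ = 0`: the limit
`1/(d-1) · lim N (h_Σ(N) - h_Σ'(N)) / binom(N+d-1, N)` exists and is equal to `c`. -/
def IsDegreeOfFreedom {d n m : ℕ} (T : Matrix (Fin n) (Fin m) (DiffPoly d)) (c : ℝ) : Prop :=
  Tendsto (fun N : ℕ => 1 / ((d : ℝ) - 1) *
      ((N : ℝ) * (((hilbertFun (solutions T) N : ℤ) : ℝ) - (hilbertFun (trivialSolutions T) N : ℤ))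
        / ((N + d - 1).choose N : ℝ)))
    atTop (𝓝 c)

/-- The physical degrees of freedom of two systems are well defined (the limits exist and are
finite) and they are equal. -/
def SameDegreeOfFreedom {d n m n' m' : ℕ} (T : Matrix (Fin n) (Fin m) (DiffPoly d))
    (T' : Matrix (Fin n') (Fin m') (DiffPoly d)) : Prop :=
  ∃ c : ℝ, IsDegreeOfFreedom T c ∧ IsDegreeOfFreedom T' c

/-- Equivalence of systems in the same fields: each is a differential consequence of the other. -/
def Equivalent {d n n' m : ℕ} (T : Matrix (Fin n) (Fin m) (DiffPoly d))
    (T' : Matrix (Fin n') (Fin m) (DiffPoly d)) : Prop :=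
  (∃ D : Matrix (Fin n') (Fin n) (DiffPoly d), D * T = T') ∧
    ∃ D' : Matrix (Fin n) (Fin n') (DiffPoly d), D' * T' = T

/-- The conjugate matrix `T†_{ia}(∂) = T_{ai}(-∂)`. -/
def conjugate {d n m : ℕ} (T : Matrix (Fin n) (Fin m) (DiffPoly d)) :
    Matrix (Fin m) (Fin n) (DiffPoly d) :=
  fun i a => MvPolynomial.aeval (fun μ => -MvPolynomial.X μ) (T a i)

/-- A system of some number of equations on some number of fields. -/
structure System (d : ℕ) where
  numEqs : ℕ
  numFields : ℕ
  matrix : Matrix (Fin numEqs) (Fin numFields) (DiffPoly d)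

/-- Elementary equivalence: the systems are equivalent (which needs the same fields), or their
conjugates are (which needs the same number of equations). -/
inductive ElementaryEquivalent {d : ℕ} : System d → System d → Prop
  | of_equivalent {n n' m : ℕ} (T : Matrix (Fin n) (Fin m) (DiffPoly d))
      (T' : Matrix (Fin n') (Fin m) (DiffPoly d)) (h : Equivalent T T') :
      ElementaryEquivalent ⟨n, m, T⟩ ⟨n', m, T'⟩
  | of_conjugate {n m m' : ℕ} (T : Matrix (Fin n) (Fin m) (DiffPoly d))
      (T' : Matrix (Fin n) (Fin m') (DiffPoly d)) (h : Equivalent (conjugate T) (conjugate T')) :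
      ElementaryEquivalent ⟨n, m, T⟩ ⟨n, m', T'⟩

/-- Weak equivalence: systems joined by a finite chain of elementary equivalences. -/
def WeaklyEquivalent {d : ℕ} : System d → System d → Prop :=
  Relation.ReflTransGen ElementaryEquivalent

end LinearPDE

end

open LinearPDE

open scoped ContDiff
open Filter Topology

noncomputable section

namespace LinearPDE

/-! The degree of freedom measures a torsion module. Pairing an operator vector `q` with a field `φ`
by the value of `q(∂)φ` at the origin, the annihilator of `Σ` is the module `rowModule T` spanned by
the rows of `T`. The nontrivial inclusion, `exists_solution_pairing_ne_zero`, constructs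
exponential-polynomial solutions by Krull's intersection theorem and the Nullstellensatz. A gauge
generator is exactly an `R` with `T R = 0`, so the annihilator of `Σ'` is `rowClosure T`, and
`rowClosure T / rowModule T` is the torsion of the module presented by `T`. Finite-dimensional
duality on jets gives `torsionDim T N = dim p_N(Σ) - dim p_N(Σ')`.

Counting leading positions and using Dickson's lemma, the order-`N` dimension of a submodule is
eventually a polynomial in `N` of degree at most `d`. A single nonzero operator kills the torsion,
which bounds `torsionDim` by a difference of shifts of such a polynomial, so its degree is below
`d`. Hence the limit exists, is finite, and depends only on the coefficient of `N^(d-1)`. That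
coefficient is unaffected by shifts of `N`, so two inequalities `torsionDim T N ≤ torsionDim T' (N +
e)`, one in each direction, force equal degrees of freedom.

Equivalent systems have the same row module and row closure. For transposes, `D` and `D'` are
mutually inverse on the torsion modules and raise orders by a bounded amount
(`Equivalent.exists_torsionDim_transpose_le`). Conjugates are transposes after `∂ ↦ -∂`, which
preserves equivalence; chains then follow step by step. -/

/-! ### Differential operators as a commutative algebra of endomorphisms -/

theorem partialDeriv_apply {d : ℕ} (μ : Fin d) (f : Smooth d) (x : Spacetime d) :
    (partialDeriv μ f : Spacetime d → ℂ) x =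
      fderiv ℝ (f : Spacetime d → ℂ) x (Pi.single μ 1) := rfl

theorem partialDeriv_commute {d : ℕ} (μ ν : Fin d) :
    Commute (partialDeriv μ) (partialDeriv ν) := by
  ext f x
  have key : ∀ μ ν : Fin d, (partialDeriv μ (partialDeriv ν f) : Spacetime d → ℂ) x =
      fderiv ℝ (fderiv ℝ (f : Spacetime d → ℂ)) x (Pi.single μ 1) (Pi.single ν 1) := by
    intro μ ν
    have hd : DifferentiableAt ℝ (fderiv ℝ (f : Spacetime d → ℂ)) x :=
      (((contDiff_smooth f).fderiv_right (m := ∞) (by simp)).differentiable (by simp)) x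
    rw [partialDeriv_apply]
    change fderiv ℝ (fun y => fderiv ℝ (f : Spacetime d → ℂ) y (Pi.single ν 1)) x _ = _
    rw [fderiv_clm_apply hd (differentiableAt_const _)]
    simp
  have hs : IsSymmSndFDerivAt ℝ (f : Spacetime d → ℂ) x :=
    ((contDiff_smooth f).contDiffAt).isSymmSndFDerivAt
      (by simpa using WithTop.coe_le_coe.2 (le_top : (2 : ℕ∞) ≤ ⊤))
  change (partialDeriv μ (partialDeriv ν f) : Spacetime d → ℂ) x =
    (partialDeriv ν (partialDeriv μ f) : Spacetime d → ℂ) x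
  rw [key, key]
  exact hs _ _

theorem list_prod_map_mul_of_commute {ι M : Type*} [Monoid M] (f g : ι → M)
    (h : ∀ i j, Commute (f i) (g j)) (l : List ι) :
    (l.map fun i => f i * g i).prod = (l.map f).prod * (l.map g).prod := by
  induction l with
  | nil => simp
  | cons a l ih =>
    have hc : Commute (g a) (l.map f).prod := by
      refine Commute.list_prod_right _ _ fun x hx => ?_
      obtain ⟨i, -, rfl⟩ := List.mem_map.1 hx
      exact (h i a).symm
    simp only [List.map_cons, List.prod_cons, ih]
    rw [mul_assoc, ← mul_assoc (g a), hc.eq]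
    simp only [mul_assoc]

/-- Multi-indices act on smooth functions by iterated derivatives. -/
def multiDerivHom (d : ℕ) : Multiplicative (Fin d →₀ ℕ) →* Module.End ℂ (Smooth d) where
  toFun α := multiDeriv α.toAdd
  map_one' := by simp [multiDeriv]
  map_mul' α β := by
    simp only [multiDeriv, toAdd_mul, Finsupp.add_apply, pow_add]
    exact list_prod_map_mul_of_commute _ _
      (fun i j => ((partialDeriv_commute i j).pow_pow _ _)) _

/-- The action of differential operators on smooth functions, as a homomorphism of algebras. -/
def diffOpHom (d : ℕ) : DiffPoly d →ₐ[ℂ] Module.End ℂ (Smooth d) :=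
  AddMonoidAlgebra.lift ℂ (Module.End ℂ (Smooth d)) (Fin d →₀ ℕ) (multiDerivHom d)

theorem diffOpHom_apply {d : ℕ} (p : DiffPoly d) : diffOpHom d p = diffOp p := by
  rw [diffOpHom, AddMonoidAlgebra.lift_apply]
  rfl

theorem diffOp_mul {d : ℕ} (p q : DiffPoly d) : diffOp (p * q) = diffOp p * diffOp q := by
  simp only [← diffOpHom_apply, map_mul]

theorem diffOp_add {d : ℕ} (p q : DiffPoly d) : diffOp (p + q) = diffOp p + diffOp q := by
  simp only [← diffOpHom_apply, map_add]

theorem diffOp_sum {d : ℕ} {ι : Type*} (s : Finset ι) (p : ι → DiffPoly d) :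
    diffOp (∑ i ∈ s, p i) = ∑ i ∈ s, diffOp (p i) := by
  simp only [← diffOpHom_apply, map_sum]

theorem diffOp_smul {d : ℕ} (c : ℂ) (p : DiffPoly d) : diffOp (c • p) = c • diffOp p := by
  simp only [← diffOpHom_apply, map_smul]

theorem diffOp_zero {d : ℕ} : diffOp (0 : DiffPoly d) = 0 := by
  simp only [← diffOpHom_apply, map_zero]

theorem diffOp_C {d : ℕ} (c : ℂ) : diffOp (MvPolynomial.C c : DiffPoly d) = c • 1 := by
  rw [← diffOpHom_apply, ← MvPolynomial.algebraMap_eq, AlgHom.commutes, Algebra.algebraMap_eq_smul_one]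

theorem diffOp_monomial {d : ℕ} (α : Fin d →₀ ℕ) (c : ℂ) :
    diffOp (MvPolynomial.monomial α c : DiffPoly d) = c • multiDeriv α := by
  rw [← diffOpHom_apply, diffOpHom]
  exact AddMonoidAlgebra.lift_single _ _ _

theorem diffOp_X {d : ℕ} (μ : Fin d) : diffOp (MvPolynomial.X μ : DiffPoly d) = partialDeriv μ := by
  rw [MvPolynomial.X, diffOp_monomial, one_smul, multiDeriv]
  rw [List.prod_map_eq_pow_single μ _ (fun ν hν _ => ?_)]
  · simp [List.count_eq_one_of_mem (List.nodup_finRange d) (List.mem_finRange μ)]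
  · simp [Finsupp.single_eq_of_ne hν]

/-! ### The pairing of operators with fields -/

/-- The value at the origin of `∑ i, q i (∂) φ i`, as a functional of `q`. -/
def pairing {d m : ℕ} (φ : Fin m → Smooth d) : (Fin m → DiffPoly d) →ₗ[ℂ] ℂ where
  toFun q := ((∑ i, diffOp (q i) (φ i) : Smooth d) : Spacetime d → ℂ) 0
  map_add' p q := by
    simp only [Pi.add_apply, diffOp_add, LinearMap.add_apply, Finset.sum_add_distrib]
    rfl
  map_smul' c q := by
    simp only [Pi.smul_apply, diffOp_smul, LinearMap.smul_apply, ← Finset.smul_sum]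
    rfl

theorem pairing_apply {d m : ℕ} (φ : Fin m → Smooth d) (q : Fin m → DiffPoly d) :
    pairing φ q = ((∑ i, diffOp (q i) (φ i) : Smooth d) : Spacetime d → ℂ) 0 := rfl

theorem matrixOp_apply {d n m : ℕ} (T : Matrix (Fin n) (Fin m) (DiffPoly d))
    (φ : Fin m → Smooth d) (a : Fin n) : matrixOp T φ a = ∑ i, diffOp (T a i) (φ i) := by
  simp [matrixOp]

/-- The submodule generated by the rows of `T`. -/
def rowModule {d n m : ℕ} (T : Matrix (Fin n) (Fin m) (DiffPoly d)) :
    Submodule (DiffPoly d) (Fin m → DiffPoly d) :=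
  LinearMap.range T.vecMulLinear

theorem pairing_eq_zero_of_mem_solutions {d n m : ℕ} {T : Matrix (Fin n) (Fin m) (DiffPoly d)}
    {φ : Fin m → Smooth d} (hφ : φ ∈ solutions T) {q : Fin m → DiffPoly d}
    (hq : q ∈ rowModule T) : pairing φ q = 0 := by
  obtain ⟨c, rfl⟩ := hq
  have h : ∀ a, ∑ i, diffOp (T a i) (φ i) = 0 := fun a => by
    rw [← matrixOp_apply, LinearMap.mem_ker.1 hφ]; rfl
  have : ∑ i, diffOp (T.vecMulLinear c i) (φ i) = 0 := by
    simp only [Matrix.vecMulLinear_apply, Matrix.vecMul, dotProduct, diffOp_sum, diffOp_mul,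
      LinearMap.sum_apply, Module.End.mul_apply]
    rw [Finset.sum_comm]
    simp only [← map_sum, h, map_zero, Finset.sum_const_zero]
  rw [pairing_apply, this]; rfl

/-! ### Exponential polynomials -/

/-- The value of a complex polynomial at a real point. -/
def realEval {d : ℕ} (f : MvPolynomial (Fin d) ℂ) (x : Spacetime d) : ℂ :=
  MvPolynomial.eval (fun μ => (x μ : ℂ)) f

theorem contDiff_coord {d : ℕ} (μ : Fin d) : ContDiff ℝ ∞ fun x : Spacetime d => (x μ : ℂ) :=
  Complex.ofRealCLM.contDiff.comp (contDiff_apply ℝ ℝ μ)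

theorem contDiff_realEval {d : ℕ} (f : MvPolynomial (Fin d) ℂ) : ContDiff ℝ ∞ (realEval f) := by
  have : realEval f = fun x : Spacetime d =>
      ∑ α ∈ f.support, f.coeff α * ∏ μ, (x μ : ℂ) ^ α μ := by
    funext x; exact MvPolynomial.eval_eq' _ _
  rw [this]
  exact ContDiff.sum fun α _ => contDiff_const.mul
    (contDiff_prod fun μ _ => (contDiff_coord μ).pow _)

theorem fderiv_coord {d : ℕ} (μ ν : Fin d) (x : Spacetime d) :
    fderiv ℝ (fun x : Spacetime d => (x ν : ℂ)) x (Pi.single μ 1) = if ν = μ then 1 else 0 := by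
  have : HasFDerivAt (fun x : Spacetime d => (x ν : ℂ))
      (Complex.ofRealCLM.comp (ContinuousLinearMap.proj ν)) x :=
    (Complex.ofRealCLM.comp (ContinuousLinearMap.proj (R := ℝ) (φ := fun _ : Fin d => ℝ) ν)).hasFDerivAt
  rw [this.fderiv]
  simp only [ContinuousLinearMap.comp_apply, ContinuousLinearMap.proj_apply, Pi.single_apply]
  split_ifs <;> simp

theorem fderiv_realEval {d : ℕ} (f : MvPolynomial (Fin d) ℂ) (μ : Fin d) (x : Spacetime d) :
    fderiv ℝ (realEval f) x (Pi.single μ 1) = realEval (MvPolynomial.pderiv μ f) x := by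
  induction f using MvPolynomial.induction_on with
  | C c =>
    have : realEval (MvPolynomial.C c : MvPolynomial (Fin d) ℂ) = fun _ => c := by
      funext y; simp [realEval]
    rw [this]
    simp [realEval]
  | add p q hp hq =>
    have : realEval (p + q) = realEval p + realEval q := by
      funext y; simp [realEval]
    rw [this, fderiv_add ((contDiff_realEval p).differentiable (by simp) x)
      ((contDiff_realEval q).differentiable (by simp) x)]
    simp [hp, hq, realEval]
  | mul_X p ν hp =>
    have : realEval (p * MvPolynomial.X ν) = fun y => realEval p y * (y ν : ℂ) := by
      funext y; simp [realEval]
    rw [this, fderiv_fun_mul ((contDiff_realEval p).differentiable (by simp) x)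
      ((contDiff_coord ν).differentiable (by simp) x)]
    simp only [add_apply, smul_apply, fderiv_coord, hp, smul_eq_mul]
    simp only [realEval, Derivation.leibniz, MvPolynomial.pderiv_X, Pi.single_apply, smul_eq_mul,
      map_add, map_mul, MvPolynomial.eval_X]
    split_ifs <;> simp

/-- The exponential with frequency `ζ`. -/
def expWave {d : ℕ} (ζ : Fin d → ℂ) (x : Spacetime d) : ℂ := Complex.exp (∑ μ, ζ μ * x μ)

theorem contDiff_expWave {d : ℕ} (ζ : Fin d → ℂ) : ContDiff ℝ ∞ (expWave ζ) :=
  Complex.contDiff_exp.comp (ContDiff.sum fun μ _ => contDiff_const.mul (contDiff_coord μ))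

theorem fderiv_expWave {d : ℕ} (ζ : Fin d → ℂ) (μ : Fin d) (x : Spacetime d) :
    fderiv ℝ (expWave ζ) x (Pi.single μ 1) = ζ μ * expWave ζ x := by
  have hc : ∀ ν : Fin d, DifferentiableAt ℝ (fun x : Spacetime d => (x ν : ℂ)) x :=
    fun ν => (contDiff_coord ν).differentiable (by simp) x
  have hd : DifferentiableAt ℝ (fun x : Spacetime d => ∑ ν, ζ ν * (x ν : ℂ)) x :=
    DifferentiableAt.fun_sum fun ν _ => (hc ν).const_mul _
  have h := (hd.hasFDerivAt.cexp).fderiv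
  change fderiv ℝ (fun x : Spacetime d => Complex.exp (∑ ν, ζ ν * (x ν : ℂ))) x _ = _
  rw [h, fderiv_fun_sum fun ν _ => (hc ν).const_mul _]
  rw [smul_apply, sum_apply, smul_eq_mul]
  rw [Finset.mul_sum, Finset.sum_eq_single μ]
  · rw [fderiv_const_mul (hc μ)]
    simp [fderiv_coord, expWave, mul_comm]
  · intro ν _ hν
    rw [fderiv_const_mul (hc ν)]
    simp [fderiv_coord, hν]
  · simp

/-- The exponential polynomial with frequency `ζ` and polynomial factor `f`. -/
def expPoly {d : ℕ} (ζ : Fin d → ℂ) : MvPolynomial (Fin d) ℂ →ₗ[ℂ] Smooth d where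
  toFun f := ⟨fun x => expWave ζ x * realEval f x, (contDiff_expWave ζ).mul (contDiff_realEval f)⟩
  map_add' f g := by
    ext x
    change expWave ζ x * realEval (f + g) x = expWave ζ x * realEval f x + expWave ζ x * realEval g x
    simp [realEval, mul_add]
  map_smul' c f := by
    ext x
    change expWave ζ x * realEval (c • f) x = c * (expWave ζ x * realEval f x)
    simp [realEval, MvPolynomial.smul_eval]
    ring

theorem expPoly_zero_apply {d : ℕ} (ζ : Fin d → ℂ) (f : MvPolynomial (Fin d) ℂ) :
    (expPoly ζ f : Spacetime d → ℂ) 0 = f.coeff 0 := by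
  change expWave ζ 0 * realEval f 0 = _
  have : realEval f 0 = f.coeff 0 := by
    have h : (fun μ : Fin d => (((0 : Spacetime d) μ : ℝ) : ℂ)) = 0 := by ext; simp
    rw [realEval, h, MvPolynomial.eval_zero, MvPolynomial.constantCoeff_eq]
  simp [this, expWave]

theorem partialDeriv_expPoly {d : ℕ} (ζ : Fin d → ℂ) (f : MvPolynomial (Fin d) ℂ) (μ : Fin d) :
    partialDeriv μ (expPoly ζ f) = expPoly ζ (ζ μ • f + MvPolynomial.pderiv μ f) := by
  ext x
  rw [partialDeriv_apply]
  change fderiv ℝ (fun x => expWave ζ x * realEval f x) x _ =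
    expWave ζ x * realEval (ζ μ • f + MvPolynomial.pderiv μ f) x
  rw [fderiv_fun_mul ((contDiff_expWave ζ).differentiable (by simp) x)
    ((contDiff_realEval f).differentiable (by simp) x)]
  simp only [add_apply, smul_apply, fderiv_realEval, fderiv_expWave, smul_eq_mul]
  simp [realEval, MvPolynomial.smul_eval]
  ring

/-- The product `∏ μ, (X μ - ζ μ) ^ α μ`. -/
def shiftedMonomial {d : ℕ} (ζ : Fin d → ℂ) (α : Fin d →₀ ℕ) : DiffPoly d :=
  ∏ μ, (MvPolynomial.X μ - MvPolynomial.C (ζ μ)) ^ α μ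

theorem shiftedMonomial_add_single {d : ℕ} (ζ : Fin d → ℂ) (α : Fin d →₀ ℕ) (μ : Fin d) :
    shiftedMonomial ζ (α + Finsupp.single μ 1) =
      shiftedMonomial ζ α * (MvPolynomial.X μ - MvPolynomial.C (ζ μ)) := by
  simp only [shiftedMonomial, Finsupp.add_apply, pow_add, Finset.prod_mul_distrib]
  congr 1
  rw [Finset.prod_eq_single μ]
  · simp
  · intro ν _ hν; simp [Finsupp.single_eq_of_ne hν]
  · simp

/-- A polynomial representing a functional `ℓ` on operators through its Taylor coefficients
at `ζ`. -/
def Represents {d : ℕ} (ζ : Fin d → ℂ) (f : MvPolynomial (Fin d) ℂ) (ℓ : DiffPoly d →ₗ[ℂ] ℂ) :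
    Prop :=
  ∀ α, f.coeff α = ℓ (shiftedMonomial ζ α) / (∏ μ, (α μ).factorial : ℕ)

/-- On the factor of `exp(ζ·x)`, the derivative `∂_μ` acts as `ζ_μ + ∂_μ`. Dually `X_μ = ζ_μ + (X_μ
- ζ_μ)`, and the second term raises the multi-index by one, the factor `α_μ + 1` being absorbed by
the factorials. -/
theorem Represents.mul_X {d : ℕ} {ζ : Fin d → ℂ} {f : MvPolynomial (Fin d) ℂ}
    {ℓ : DiffPoly d →ₗ[ℂ] ℂ} (h : Represents ζ f ℓ) (μ : Fin d) :
    Represents ζ (ζ μ • f + MvPolynomial.pderiv μ f)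
      (ℓ ∘ₗ LinearMap.mulLeft ℂ (MvPolynomial.X μ)) := by
  intro α
  have hfac : ((∏ ν, ((α + Finsupp.single μ 1 : Fin d →₀ ℕ) ν).factorial : ℕ) : ℂ) =
      (α μ + 1) * (∏ ν, (α ν).factorial : ℕ) := by
    have : (∏ ν, ((α + Finsupp.single μ 1 : Fin d →₀ ℕ) ν).factorial : ℕ) =
        (α μ + 1) * ∏ ν, (α ν).factorial := by
      rw [← Finset.mul_prod_erase _ _ (Finset.mem_univ μ),
        ← Finset.mul_prod_erase (Finset.univ : Finset (Fin d)) (fun ν => (α ν).factorial)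
          (Finset.mem_univ μ), ← mul_assoc]
      congr 1
      · simp [Nat.factorial_succ]
      · refine Finset.prod_congr rfl fun ν hν => ?_
        simp [Finsupp.single_eq_of_ne (Finset.ne_of_mem_erase hν)]
    rw [this]; push_cast; ring
  have hne : ((∏ ν, (α ν).factorial : ℕ) : ℂ) ≠ 0 :=
    Nat.cast_ne_zero.2 (Finset.prod_ne_zero_iff.2 fun ν _ => Nat.factorial_ne_zero _)
  have hne' : (α μ + 1 : ℂ) ≠ 0 := Nat.cast_add_one_ne_zero _
  rw [MvPolynomial.coeff_add, MvPolynomial.coeff_smul, MvPolynomial.coeff_pderiv, h, h, hfac,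
    shiftedMonomial_add_single, LinearMap.comp_apply, LinearMap.mulLeft_apply, mul_sub,
    mul_comm _ (MvPolynomial.C _), ← MvPolynomial.smul_eq_C_mul, map_sub, map_smul,
    mul_comm (MvPolynomial.X μ)]
  simp only [smul_eq_mul]
  field_simp
  ring

theorem Represents.diffOp_expPoly {d : ℕ} {ζ : Fin d → ℂ} {f : MvPolynomial (Fin d) ℂ}
    {ℓ : DiffPoly d →ₗ[ℂ] ℂ} (h : Represents ζ f ℓ) (p : DiffPoly d) :
    ∃ g, Represents ζ g (ℓ ∘ₗ LinearMap.mulLeft ℂ p) ∧ diffOp p (expPoly ζ f) = expPoly ζ g := by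
  induction p using MvPolynomial.induction_on generalizing f ℓ with
  | C c =>
    refine ⟨c • f, fun α => ?_, by simp [diffOp_C]⟩
    rw [MvPolynomial.coeff_smul, h, LinearMap.comp_apply, LinearMap.mulLeft_apply,
      ← MvPolynomial.smul_eq_C_mul, map_smul, smul_eq_mul, smul_eq_mul, mul_div_assoc]
  | add p q hp hq =>
    obtain ⟨g₁, h₁, e₁⟩ := hp h
    obtain ⟨g₂, h₂, e₂⟩ := hq h
    refine ⟨g₁ + g₂, fun α => ?_, by rw [diffOp_add, LinearMap.add_apply, e₁, e₂, map_add]⟩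
    rw [MvPolynomial.coeff_add, h₁, h₂, ← add_div]
    simp [add_mul]
  | mul_X p μ hp =>
    obtain ⟨g, hg, e⟩ := hp (h.mul_X μ)
    refine ⟨g, fun α => ?_, by
      rw [diffOp_mul, Module.End.mul_apply, diffOp_X, partialDeriv_expPoly, e]⟩
    rw [hg]
    simp [mul_left_comm]

theorem Represents.coeff_zero {d : ℕ} {ζ : Fin d → ℂ} {f : MvPolynomial (Fin d) ℂ}
    {ℓ : DiffPoly d →ₗ[ℂ] ℂ} (h : Represents ζ f ℓ) : f.coeff 0 = ℓ 1 := by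
  simp [h 0, shiftedMonomial]

theorem Represents.ext {d : ℕ} {ζ : Fin d → ℂ} {f g : MvPolynomial (Fin d) ℂ}
    {ℓ : DiffPoly d →ₗ[ℂ] ℂ} (hf : Represents ζ f ℓ) (hg : Represents ζ g ℓ) : f = g :=
  MvPolynomial.ext _ _ fun α => by rw [hf, hg]

theorem Represents.sum {d : ℕ} {ι : Type*} (s : Finset ι) {ζ : Fin d → ℂ}
    {f : ι → MvPolynomial (Fin d) ℂ} {ℓ : ι → DiffPoly d →ₗ[ℂ] ℂ}
    (h : ∀ i, Represents ζ (f i) (ℓ i)) : Represents ζ (∑ i ∈ s, f i) (∑ i ∈ s, ℓ i) := fun α => by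
  rw [MvPolynomial.coeff_sum, LinearMap.sum_apply, Finset.sum_div]
  exact Finset.sum_congr rfl fun i _ => h i α

/-- Shifted monomials of degree at least `k` lie in `I ^ k`, so only finitely many Taylor
coefficients survive and the formal series is a polynomial. -/
theorem exists_represents {d : ℕ} {ζ : Fin d → ℂ} {I : Ideal (DiffPoly d)}
    (hI : ∀ μ, MvPolynomial.X μ - MvPolynomial.C (ζ μ) ∈ I) {k : ℕ} {ℓ : DiffPoly d →ₗ[ℂ] ℂ}
    (hℓ : ∀ p ∈ I ^ k, ℓ p = 0) : ∃ f, Represents ζ f ℓ := by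
  have hmem : ∀ α : Fin d →₀ ℕ, shiftedMonomial ζ α ∈ I ^ (∑ μ, α μ) := fun α => by
    rw [← Finset.prod_pow_eq_pow_sum]
    exact Ideal.prod_mem_prod fun μ _ => Ideal.pow_mem_pow (hI μ) _
  have hz : ∀ α : Fin d →₀ ℕ, k ≤ ∑ μ, α μ → ℓ (shiftedMonomial ζ α) = 0 :=
    fun α hα => hℓ _ (Ideal.pow_le_pow_right hα (hmem α))
  refine ⟨∑ j ∈ Finset.range k, ∑ α ∈ (Finset.univ : Finset (Fin d)).finsuppAntidiag j,
    MvPolynomial.monomial α (ℓ (shiftedMonomial ζ α) / (∏ μ, (α μ).factorial : ℕ)), fun α => ?_⟩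
  simp only [MvPolynomial.coeff_sum, MvPolynomial.coeff_monomial, Finset.sum_ite_eq',
    Finset.mem_finsuppAntidiag, Finset.subset_univ, and_true, Finset.sum_ite_eq, Finset.mem_range]
  split_ifs with h
  · rfl
  · rw [hz α (not_lt.1 h), zero_div]

/-! ### Duality between solutions and the row module -/

/-- The class `x` of `q` modulo the rows is nonzero, hence survives modulo `I ^ k` for some maximal
ideal `I` and some `k`. By the Nullstellensatz `I` is a point `ζ`, and a linear functional vanishing
on `I ^ k • M` but not at `x` is realised by a field of exponential polynomials of frequency `ζ`. -/
theorem exists_solution_pairing_ne_zero {d n m : ℕ} (T : Matrix (Fin n) (Fin m) (DiffPoly d))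
    {q : Fin m → DiffPoly d} (hq : q ∉ rowModule T) : ∃ φ ∈ solutions T, pairing φ q ≠ 0 := by
  set K := rowModule T with hK
  let M := (Fin m → DiffPoly d) ⧸ K
  let x : M := K.mkQ q
  have hx : x ≠ 0 := fun h => hq ((Submodule.Quotient.mk_eq_zero K).1 h)
  have hann : Ideal.span {p : DiffPoly d | p • x = 0} ≠ ⊤ := by
    have : Ideal.span {p : DiffPoly d | p • x = 0} ≤ LinearMap.ker (LinearMap.toSpanSingleton (DiffPoly d) M x) :=
      Ideal.span_le.2 fun p hp => by simpa using hp
    intro h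
    rw [h] at this
    have h1 : (1 : DiffPoly d) ∈ LinearMap.ker (LinearMap.toSpanSingleton (DiffPoly d) M x) := this trivial
    simp at h1
    exact hx h1
  obtain ⟨I, hI, hle⟩ := Ideal.exists_le_maximal _ hann
  -- Krull: membership in the intersection means `r • x = x` with `r ∈ I`. Then `1 - r` annihilates
  -- `x`, hence lies in `I`, and so does `1`.
  have hnot : x ∉ (⨅ i : ℕ, I ^ i • ⊤ : Submodule (DiffPoly d) M) := by
    rw [Ideal.mem_iInf_smul_pow_eq_bot_iff]
    rintro ⟨r, hr⟩
    have h1 : (1 - (r : DiffPoly d)) ∈ I := hle (Ideal.subset_span (by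
      change (1 - (r : DiffPoly d)) • x = 0
      rw [sub_smul, hr, one_smul, sub_self]))
    exact hI.ne_top ((Ideal.eq_top_iff_one I).2 (by simpa using I.add_mem h1 r.2))
  obtain ⟨k, hk⟩ : ∃ k, x ∉ (I ^ k • ⊤ : Submodule (DiffPoly d) M) := by
    simpa [Submodule.mem_iInf] using hnot
  obtain ⟨ζ, hζ⟩ := MvPolynomial.isMaximal_iff_eq_vanishingIdeal_singleton.1 hI
  have hXI : ∀ μ, (MvPolynomial.X μ - MvPolynomial.C (ζ μ) : DiffPoly d) ∈ I := fun μ => by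
    rw [hζ, MvPolynomial.mem_vanishingIdeal_singleton_iff]; simp
  obtain ⟨lam, hlam, hlam0⟩ := Submodule.exists_le_ker_of_notMem
    (p := (I ^ k • ⊤ : Submodule (DiffPoly d) M).restrictScalars ℂ) (v := x) hk
  let ℓ : Fin m → DiffPoly d →ₗ[ℂ] ℂ := fun i =>
    lam ∘ₗ K.mkQ.restrictScalars ℂ ∘ₗ (LinearMap.single (DiffPoly d) (fun _ : Fin m => DiffPoly d) i).restrictScalars ℂ
  have hℓ : ∀ i, ∀ p ∈ I ^ k, ℓ i p = 0 := fun i p hp => by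
    refine LinearMap.mem_ker.1 (hlam0 ?_)
    have : (p : DiffPoly d) • K.mkQ (Pi.single i 1) ∈ (I ^ k • ⊤ : Submodule (DiffPoly d) M) :=
      Submodule.smul_mem_smul hp trivial
    rw [← map_smul, ← Pi.single_smul, smul_eq_mul, mul_one] at this
    exact this
  choose f hf using fun i => exists_represents hXI (hℓ i)
  have hsum : ∀ v : Fin m → DiffPoly d,
      (∑ i, ℓ i ∘ₗ LinearMap.mulLeft ℂ (v i)) =
        lam ∘ₗ K.mkQ.restrictScalars ℂ ∘ₗ
          (LinearMap.toSpanSingleton (DiffPoly d) (Fin m → DiffPoly d) v).restrictScalars ℂ := by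
    intro v
    refine LinearMap.ext fun p => ?_
    rw [LinearMap.sum_apply]
    change (∑ i, lam (K.mkQ (Pi.single i (v i * p)))) = lam (K.mkQ (p • v))
    rw [← map_sum, ← map_sum, Finset.univ_sum_single]
    congr 2
    funext i
    simp [mul_comm]
  have hkey : ∀ v : Fin m → DiffPoly d, ∃ g,
      Represents ζ g (∑ i, ℓ i ∘ₗ LinearMap.mulLeft ℂ (v i)) ∧
      ∑ i, diffOp (v i) (expPoly ζ (f i)) = expPoly ζ g := by
    intro v
    choose g hg e using fun i => (hf i).diffOp_expPoly (v i)
    exact ⟨∑ i, g i, Represents.sum _ hg, by simp only [e, map_sum]⟩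
  refine ⟨fun i => expPoly ζ (f i), ?_, ?_⟩
  · refine LinearMap.mem_ker.2 (funext fun a => ?_)
    rw [matrixOp_apply]
    obtain ⟨g, hg, e⟩ := hkey (T a)
    rw [e]
    have hrow : ∀ p : DiffPoly d, p • T a ∈ K := fun p => by
      refine K.smul_mem p ⟨Pi.single a 1, ?_⟩
      simp [Matrix.row]
    -- The functional representing `T_a φ` is `p ↦ lam (p • T_a)`, which is zero because rows vanish
    -- in the quotient.
    have hz : (∑ i, ℓ i ∘ₗ LinearMap.mulLeft ℂ (T a i)) = 0 := by
      rw [hsum]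
      refine LinearMap.ext fun p => ?_
      change lam (K.mkQ (p • T a)) = 0
      rw [(Submodule.Quotient.mk_eq_zero K).2 (hrow p) |> (show K.mkQ (p • T a) = 0 from ·), map_zero]
    rw [hz] at hg
    have : g = 0 := hg.ext fun α => by simp
    rw [this, map_zero]; rfl
  · obtain ⟨g, hg, e⟩ := hkey q
    rw [pairing_apply, e, expPoly_zero_apply, hg.coeff_zero, hsum]
    change lam (K.mkQ ((1 : DiffPoly d) • q)) ≠ 0
    rw [one_smul]
    exact hlam

/-! ### Gauge symmetries and the annihilator of the trivial solutions -/

theorem eq_zero_of_diffOp_apply_zero {d : ℕ} {p : DiffPoly d}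
    (h : ∀ ε : Smooth d, (diffOp p ε : Spacetime d → ℂ) 0 = 0) : p = 0 := by
  by_contra hp
  -- The empty system has zero row module and no constraint on its solutions.
  let T : Matrix (Fin 0) (Fin 1) (DiffPoly d) := 0
  have hq : (fun _ : Fin 1 => p) ∉ rowModule T := by
    rintro ⟨c, hc⟩
    have := congr_fun hc 0
    simp [Matrix.vecMul, dotProduct] at this
    exact hp this.symm
  obtain ⟨φ, -, hφ⟩ := exists_solution_pairing_ne_zero T hq
  refine hφ ?_
  rw [pairing_apply]
  simpa using h (φ 0)

theorem matrixOp_gaugeTransform {d n m : ℕ} (T : Matrix (Fin n) (Fin m) (DiffPoly d))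
    (R : Fin m → DiffPoly d) (ε : Smooth d) (a : Fin n) :
    matrixOp T (gaugeTransform R ε) a = diffOp (T.mulVec R a) ε := by
  simp only [matrixOp_apply, gaugeTransform, Matrix.mulVec, dotProduct, diffOp_sum, diffOp_mul,
    LinearMap.sum_apply, Module.End.mul_apply]

theorem pairing_gaugeTransform {d m : ℕ} (q R : Fin m → DiffPoly d) (ε : Smooth d) :
    pairing (gaugeTransform R ε) q = (diffOp (q ⬝ᵥ R) ε : Spacetime d → ℂ) 0 := by
  simp only [pairing_apply, gaugeTransform, dotProduct, diffOp_sum, diffOp_mul,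
    LinearMap.sum_apply, Module.End.mul_apply]

theorem isGaugeSymmetry_iff {d n m : ℕ} {T : Matrix (Fin n) (Fin m) (DiffPoly d)}
    {R : Fin m → DiffPoly d} : IsGaugeSymmetry T R ↔ T.mulVec R = 0 := by
  constructor
  · intro h
    funext a
    refine eq_zero_of_diffOp_apply_zero fun ε => ?_
    rw [← matrixOp_gaugeTransform, LinearMap.mem_ker.1 (h ε)]; rfl
  · intro h ε
    refine LinearMap.mem_ker.2 (funext fun a => ?_)
    rw [matrixOp_gaugeTransform, h, Pi.zero_apply, diffOp_zero]; rfl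

/-- The operators orthogonal to all gauge generators of `T`; these are the torsion elements
modulo the row module. -/
def rowClosure {d n m : ℕ} (T : Matrix (Fin n) (Fin m) (DiffPoly d)) :
    Submodule (DiffPoly d) (Fin m → DiffPoly d) where
  carrier := {q | ∀ R, T.mulVec R = 0 → q ⬝ᵥ R = 0}
  add_mem' hp hq R hR := by rw [add_dotProduct, hp R hR, hq R hR, add_zero]
  zero_mem' R _ := zero_dotProduct R
  smul_mem' c q hq R hR := by rw [smul_dotProduct, hq R hR, smul_zero]

theorem rowModule_le_rowClosure {d n m : ℕ} (T : Matrix (Fin n) (Fin m) (DiffPoly d)) :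
    rowModule T ≤ rowClosure T := by
  rintro _ ⟨c, rfl⟩ R hR
  rw [Matrix.vecMulLinear_apply, ← Matrix.dotProduct_mulVec, hR, dotProduct_zero]

theorem mem_rowModule_iff_pairing {d n m : ℕ} {T : Matrix (Fin n) (Fin m) (DiffPoly d)}
    {q : Fin m → DiffPoly d} : q ∈ rowModule T ↔ ∀ φ ∈ solutions T, pairing φ q = 0 := by
  refine ⟨fun hq φ hφ => pairing_eq_zero_of_mem_solutions hφ hq, fun h => ?_⟩
  by_contra hq
  obtain ⟨φ, hφ, hne⟩ := exists_solution_pairing_ne_zero T hq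
  exact hne (h φ hφ)

theorem pairing_zero {d m : ℕ} (q : Fin m → DiffPoly d) :
    pairing (0 : Fin m → Smooth d) q = 0 := by
  simp [pairing_apply]

theorem pairing_add {d m : ℕ} (φ ψ : Fin m → Smooth d) (q : Fin m → DiffPoly d) :
    pairing (φ + ψ) q = pairing φ q + pairing ψ q := by
  simp only [pairing_apply, Pi.add_apply, map_add, Finset.sum_add_distrib]
  rfl

theorem pairing_smul {d m : ℕ} (c : ℂ) (φ : Fin m → Smooth d) (q : Fin m → DiffPoly d) :
    pairing (c • φ) q = c * pairing φ q := by
  simp only [pairing_apply, Pi.smul_apply, map_smul, ← Finset.smul_sum]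
  rfl

theorem mem_rowClosure_iff_pairing {d n m : ℕ} {T : Matrix (Fin n) (Fin m) (DiffPoly d)}
    {q : Fin m → DiffPoly d} :
    q ∈ rowClosure T ↔ ∀ φ ∈ trivialSolutions T, pairing φ q = 0 := by
  constructor
  · intro hq φ hφ
    induction hφ using Submodule.span_induction with
    | mem φ hφ =>
      obtain ⟨R, hR, ε, rfl⟩ := hφ
      rw [pairing_gaugeTransform, hq R (isGaugeSymmetry_iff.1 hR), diffOp_zero]; rfl
    | zero => exact pairing_zero q
    | add φ ψ _ _ h₁ h₂ => rw [pairing_add, h₁, h₂, add_zero]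
    | smul c φ _ h => rw [pairing_smul, h, mul_zero]
  · intro h R hR
    refine eq_zero_of_diffOp_apply_zero fun ε => ?_
    rw [← pairing_gaugeTransform]
    exact h _ (Submodule.subset_span ⟨R, isGaugeSymmetry_iff.2 hR, ε, rfl⟩)

/-! ### Order filtration, jets and Taylor polynomials -/

/-- The vectors of operators of order at most `N`. -/
def degLE (d m N : ℕ) : Submodule ℂ (Fin m → DiffPoly d) where
  carrier := {q | ∀ i α, N < α.degree → (q i).coeff α = 0}
  add_mem' hp hq i α h := by
    rw [Pi.add_apply, MvPolynomial.coeff_add, hp i α h, hq i α h, add_zero]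
  zero_mem' _ _ _ := MvPolynomial.coeff_zero _
  smul_mem' c q hq i α h := by rw [Pi.smul_apply, MvPolynomial.coeff_smul, hq i α h, smul_zero]

theorem mem_degLE {d m N : ℕ} {q : Fin m → DiffPoly d} :
    q ∈ degLE d m N ↔ ∀ i α, N < α.degree → (q i).coeff α = 0 := Iff.rfl

/-- The dimension of the space of elements of `K` of order at most `N`. -/
def orderDim {d m : ℕ} (K : Submodule (DiffPoly d) (Fin m → DiffPoly d)) (N : ℕ) : ℕ :=
  Module.finrank ℂ ↥(K.restrictScalars ℂ ⊓ degLE d m N)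

/-- The multi-indices of order at most `N`. -/
def multiIndices (d N : ℕ) : Finset (Fin d →₀ ℕ) :=
  (Finset.range (N + 1)).biUnion fun k => (Finset.univ : Finset (Fin d)).finsuppAntidiag k

theorem mem_multiIndices {d N : ℕ} {α : Fin d →₀ ℕ} : α ∈ multiIndices d N ↔ α.degree ≤ N := by
  simp [multiIndices, Finsupp.degree_eq_sum]

/-- The vector of polynomials with weighted coefficients `w α * c (i, α)`. -/
def ofCoeffs {d : ℕ} (m N : ℕ) (w : (Fin d →₀ ℕ) → ℂ) :
    (Fin m × multiIndices d N → ℂ) →ₗ[ℂ] (Fin m → MvPolynomial (Fin d) ℂ) :=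
  LinearMap.pi fun i => ∑ α : multiIndices d N,
    w α • (MvPolynomial.monomial (α : Fin d →₀ ℕ) ∘ₗ LinearMap.proj (i, α))

theorem ofCoeffs_apply {d : ℕ} {m N : ℕ} {w : (Fin d →₀ ℕ) → ℂ}
    (c : Fin m × multiIndices d N → ℂ) (i : Fin m) :
    ofCoeffs m N w c i = ∑ α : multiIndices d N,
      w α • MvPolynomial.monomial (α : Fin d →₀ ℕ) (c (i, α)) := by
  simp [ofCoeffs]

theorem coeff_ofCoeffs {d : ℕ} {m N : ℕ} {w : (Fin d →₀ ℕ) → ℂ}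
    (c : Fin m × multiIndices d N → ℂ) (i : Fin m) (α : Fin d →₀ ℕ) :
    (ofCoeffs m N w c i).coeff α =
      if h : α ∈ multiIndices d N then w α * c (i, ⟨α, h⟩) else 0 := by
  rw [ofCoeffs_apply, MvPolynomial.coeff_sum]
  simp only [MvPolynomial.coeff_smul, MvPolynomial.coeff_monomial, smul_eq_mul]
  split_ifs with h
  · rw [Finset.sum_eq_single ⟨α, h⟩]
    · simp
    · rintro ⟨β, hβ⟩ _ hne
      rw [if_neg fun e : β = α => hne (Subtype.ext e), mul_zero]
    · simp
  · refine Finset.sum_eq_zero fun β _ => ?_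
    rw [if_neg fun e : (β : Fin d →₀ ℕ) = α => h (e ▸ β.2), mul_zero]

theorem ofCoeffs_injective {d : ℕ} {m N : ℕ} {w : (Fin d →₀ ℕ) → ℂ} (hw : ∀ α, w α ≠ 0) :
    Function.Injective (ofCoeffs m N w) := by
  intro c c' h
  funext ⟨i, α⟩
  have := congr_arg (MvPolynomial.coeff (α : Fin d →₀ ℕ)) (congr_fun h i)
  rw [coeff_ofCoeffs, coeff_ofCoeffs, dif_pos α.2, dif_pos α.2] at this
  exact mul_left_cancel₀ (hw _) this

theorem range_ofCoeffs {d : ℕ} (m N : ℕ) :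
    LinearMap.range (ofCoeffs m N (fun _ : Fin d →₀ ℕ => 1)) = degLE d m N := by
  ext q
  constructor
  · rintro ⟨c, rfl⟩ i α hα
    rw [coeff_ofCoeffs, dif_neg]
    rw [mem_multiIndices]; omega
  · intro hq
    refine ⟨fun x => (q x.1).coeff x.2, funext fun i => MvPolynomial.ext _ _ fun α => ?_⟩
    rw [coeff_ofCoeffs]
    split_ifs with h
    · simp
    · rw [hq i α]
      rw [mem_multiIndices] at h; omega

/-- The derivatives up to order `N` at the origin. -/
def jet (d m N : ℕ) : (Fin m → Smooth d) →ₗ[ℂ] (Fin m × multiIndices d N → ℂ) :=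
  LinearMap.pi fun x => LinearMap.proj (0 : Spacetime d) ∘ₗ (Smooth d).subtype ∘ₗ
    multiDeriv (x.2 : Fin d →₀ ℕ) ∘ₗ LinearMap.proj x.1

theorem jet_apply {d m N : ℕ} (φ : Fin m → Smooth d) (x : Fin m × multiIndices d N) :
    jet d m N φ x = (multiDeriv (x.2 : Fin d →₀ ℕ) (φ x.1) : Spacetime d → ℂ) 0 := rfl

theorem taylorProj_eq_ofCoeffs_comp_jet (d m N : ℕ) :
    taylorProj m N = ofCoeffs m N
      (fun α : Fin d →₀ ℕ => ((∏ μ, (α μ).factorial : ℕ) : ℂ)⁻¹) ∘ₗ jet d m N := by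
  refine LinearMap.ext fun φ => funext fun i => ?_
  rw [LinearMap.comp_apply, ofCoeffs_apply]
  simp only [jet_apply]
  rw [Finset.sum_coe_sort (multiIndices d N) (fun α => ((∏ μ, (α μ).factorial : ℕ) : ℂ)⁻¹ •
      MvPolynomial.monomial α ((multiDeriv α (φ i) : Spacetime d → ℂ) 0)), multiIndices,
    Finset.sum_biUnion]
  · simp only [taylorProj, LinearMap.pi_apply, LinearMap.comp_apply, LinearMap.sum_apply,
      LinearMap.proj_apply]
    refine Finset.sum_congr rfl fun k _ => Finset.sum_congr rfl fun α _ => ?_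
    rw [← map_smul]
    rfl
  · intro j _ k _ hjk
    refine Finset.disjoint_left.2 fun α hj hk => hjk ?_
    rw [← (Finset.mem_finsuppAntidiag.1 hj).1, ← (Finset.mem_finsuppAntidiag.1 hk).1]

theorem pairing_ofCoeffs {d m N : ℕ} (φ : Fin m → Smooth d) (c : Fin m × multiIndices d N → ℂ) :
    pairing φ (ofCoeffs m N (fun _ => 1) c) = c ⬝ᵥ jet d m N φ := by
  have h : ∀ q : Fin m → DiffPoly d, pairing φ q =
      ∑ i, ((diffOp (q i) (φ i) : Smooth d) : Spacetime d → ℂ) 0 := fun q => by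
    rw [pairing_apply]
    exact map_sum (LinearMap.proj (0 : Spacetime d) ∘ₗ (Smooth d).subtype) _ _
  rw [h, dotProduct, Fintype.sum_prod_type]
  refine Finset.sum_congr rfl fun i _ => ?_
  rw [ofCoeffs_apply, diffOp_sum, LinearMap.sum_apply]
  refine (map_sum (LinearMap.proj (0 : Spacetime d) ∘ₗ (Smooth d).subtype) _ _).trans
    (Finset.sum_congr rfl fun α _ => ?_)
  rw [one_smul, diffOp_monomial]
  rfl

/-- The projection `p_N` is the jet followed by an injective rescaling by `1/α!`. The operators in
`K` of order at most `N` form the annihilator of the space of jets, so the two dimensions are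
complementary. -/
theorem finrank_map_taylorProj_add_orderDim {d m : ℕ} {S : Submodule ℂ (Fin m → Smooth d)}
    {K : Submodule (DiffPoly d) (Fin m → DiffPoly d)}
    (h : ∀ q, q ∈ K ↔ ∀ φ ∈ S, pairing φ q = 0) (N : ℕ) :
    Module.finrank ℂ (S.map (taylorProj m N)) + orderDim K N =
      m * (multiIndices d N).card := by
  classical
  set W := S.map (jet d m N) with hW
  have h₁ : Module.finrank ℂ (S.map (taylorProj m N)) = Module.finrank ℂ W := by
    rw [taylorProj_eq_ofCoeffs_comp_jet, Submodule.map_comp]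
    refine (LinearEquiv.finrank_eq (Submodule.equivMapOfInjective _ (ofCoeffs_injective fun α => ?_)
      W)).symm
    exact inv_ne_zero (Nat.cast_ne_zero.2
      (Finset.prod_ne_zero_iff.2 fun ν _ => Nat.factorial_ne_zero _))
  let e := dotProductEquiv ℂ (Fin m × multiIndices d N)
  let A := W.dualAnnihilator.comap e.toLinearMap
  have h₂ : Module.finrank ℂ A = Module.finrank ℂ W.dualAnnihilator :=
    LinearEquiv.finrank_eq (e.submoduleMap A |>.trans (LinearEquiv.ofEq _ _
      (Submodule.map_comap_eq_of_surjective e.surjective _)))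
  have h₃ : A.map (ofCoeffs m N fun _ => 1) = K.restrictScalars ℂ ⊓ degLE d m N := by
    have hA : ∀ c, c ∈ A ↔ ofCoeffs m N (fun _ => 1) c ∈ K := by
      intro c
      rw [h, Submodule.mem_comap, Submodule.mem_dualAnnihilator]
      constructor
      · intro hc φ hφ
        rw [pairing_ofCoeffs]
        exact hc _ (Submodule.mem_map_of_mem hφ)
      · rintro hc _ ⟨φ, hφ, rfl⟩
        have := hc φ hφ
        rwa [pairing_ofCoeffs] at this
    rw [← range_ofCoeffs]
    ext q
    constructor
    · rintro ⟨c, hc, rfl⟩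
      exact ⟨(hA c).1 hc, c, rfl⟩
    · rintro ⟨hq, c, rfl⟩
      exact ⟨c, (hA c).2 hq, rfl⟩
  have h₄ : orderDim K N = Module.finrank ℂ A := by
    rw [orderDim, ← h₃]
    exact (LinearEquiv.finrank_eq (Submodule.equivMapOfInjective _
      (ofCoeffs_injective fun α => one_ne_zero) A)).symm
  rw [h₁, h₄, h₂, Subspace.finrank_add_finrank_dualAnnihilator_eq]
  simp

/-! ### Leading positions -/

/-- The elements of `V` all of whose coordinates outside `s` vanish. -/
def supportedIn {k W B : Type*} [Field k] [AddCommGroup W] [Module k W] (c : B → W →ₗ[k] k)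
    (V : Submodule k W) (s : Finset B) : Submodule k W where
  carrier := {w | w ∈ V ∧ ∀ b ∉ s, c b w = 0}
  add_mem' hv hw := ⟨V.add_mem hv.1 hw.1, fun b hb => by rw [map_add, hv.2 b hb, hw.2 b hb, add_zero]⟩
  zero_mem' := ⟨V.zero_mem, fun b _ => map_zero _⟩
  smul_mem' a w hw := ⟨V.smul_mem a hw.1, fun b hb => by rw [map_smul, hw.2 b hb, smul_zero]⟩

theorem mem_supportedIn {k W B : Type*} [Field k] [AddCommGroup W] [Module k W]
    {c : B → W →ₗ[k] k} {V : Submodule k W} {s : Finset B} {w : W} :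
    w ∈ supportedIn c V s ↔ w ∈ V ∧ ∀ b ∉ s, c b w = 0 := Iff.rfl

open scoped Classical in
/-- The dimension of a space supported in a finite linearly ordered set of coordinates is the number
of positions of leading coordinates. -/
theorem finrank_supportedIn_eq_card {k W B : Type*} [Field k] [AddCommGroup W] [Module k W]
    [LinearOrder B] (c : B → W →ₗ[k] k) (hc : ∀ w, (∀ b, c b w = 0) → w = 0) (V : Submodule k W)
    (s : Finset B) :
    Module.Finite k (supportedIn c V s) ∧ Module.finrank k (supportedIn c V s) =
      (s.filter fun b => ∃ w ∈ supportedIn c V s, c b w ≠ 0 ∧ ∀ b' > b, c b' w = 0).card := by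
  have hfin : ∀ s : Finset B, Module.Finite k (supportedIn c V s) := fun s => by
    refine Module.Finite.of_injective
      ((LinearMap.pi fun b : s => c b) ∘ₗ (supportedIn c V s).subtype) ?_
    rw [← LinearMap.ker_eq_bot, LinearMap.ker_eq_bot']
    rintro ⟨w, hw⟩ h
    refine Subtype.ext (hc w fun b => ?_)
    by_cases hb : b ∈ s
    · exact congr_fun h ⟨b, hb⟩
    · exact hw.2 b hb
  refine ⟨hfin s, ?_⟩
  induction s using Finset.induction_on_max with
  | empty =>
    have : supportedIn c V ∅ = ⊥ := by
      rw [eq_bot_iff]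
      intro w hw
      exact hc w fun b => hw.2 b (Finset.notMem_empty b)
    rw [this, finrank_bot]; rfl
  | insert a s hmax ih =>
    have ha : a ∉ s := fun h => lt_irrefl _ (hmax a h)
    set U := supportedIn c V (insert a s)
    have := hfin (insert a s)
    -- The kernel of the new top coordinate is the previous space, and its rank is 1 exactly when
    -- `a` is a leading position.
    let f : U →ₗ[k] k := c a ∘ₗ U.subtype
    have hsub : ∀ w, w ∈ supportedIn c V s ↔ w ∈ U ∧ c a w = 0 := by
      intro w
      constructor
      · intro hw
        exact ⟨⟨hw.1, fun b hb => hw.2 b fun h => hb (Finset.mem_insert_of_mem h)⟩, hw.2 a ha⟩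
      · rintro ⟨hw, hwa⟩
        refine ⟨hw.1, fun b hb => ?_⟩
        by_cases hba : b = a
        · rwa [hba]
        · exact hw.2 b (by simp [hba, hb])
    have hker : Module.finrank k (LinearMap.ker f) = Module.finrank k (supportedIn c V s) := by
      have : (LinearMap.ker f).map U.subtype = supportedIn c V s := by
        ext w
        rw [hsub]
        constructor
        · rintro ⟨⟨w, hw⟩, h, rfl⟩
          exact ⟨hw, h⟩
        · rintro ⟨hw, h⟩
          exact ⟨⟨w, hw⟩, h, rfl⟩
      rw [← this]
      exact LinearEquiv.finrank_eq (Submodule.equivMapOfInjective _ U.injective_subtype _)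
    have hfilter : (s.filter fun b => ∃ w ∈ U, c b w ≠ 0 ∧ ∀ b' > b, c b' w = 0) =
        s.filter fun b => ∃ w ∈ supportedIn c V s, c b w ≠ 0 ∧ ∀ b' > b, c b' w = 0 := by
      refine Finset.filter_congr fun b hb => ?_
      constructor
      · rintro ⟨w, hw, h1, h2⟩
        exact ⟨w, (hsub w).2 ⟨hw, h2 a (hmax b hb)⟩, h1, h2⟩
      · rintro ⟨w, hw, h1, h2⟩
        exact ⟨w, ((hsub w).1 hw).1, h1, h2⟩
    have hrank := f.finrank_range_add_finrank_ker
    rw [hker, ih, ← hfilter] at hrank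
    rw [← hrank, Finset.filter_insert]
    have hhigh : ∀ w ∈ U, ∀ b' > a, c b' w = 0 := fun w hw b' hb' => hw.2 b' (by
      rw [Finset.mem_insert, not_or]
      exact ⟨hb'.ne', fun h => lt_asymm hb' (hmax b' h)⟩)
    split_ifs with h
    · obtain ⟨w, hw, hne, -⟩ := h
      have : LinearMap.range f = ⊤ := LinearMap.range_eq_top.2
        (LinearMap.surjective_of_ne_zero fun h0 => hne (LinearMap.congr_fun h0 ⟨w, hw⟩))
      rw [Finset.card_insert_of_notMem (by simp [ha]), this, finrank_top, Module.finrank_self,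
        add_comm]
    · have : LinearMap.range f = ⊥ := LinearMap.range_eq_bot.2 (LinearMap.ext fun w => by
        by_contra hne
        exact h ⟨w, w.2, hne, hhigh w w.2⟩)
      rw [this, finrank_bot, zero_add]

/-- The position `(α, i)` carries the leading coefficient of an element of `K`. -/
def IsLead {d m : ℕ} (K : Submodule (DiffPoly d) (Fin m → DiffPoly d)) (i : Fin m)
    (α : Fin d →₀ ℕ) : Prop :=
  ∃ w ∈ K, (w i).coeff α ≠ 0 ∧ ∀ β j, toLex (toDegLex α, i) < toLex (toDegLex β, j) →
    (w j).coeff β = 0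

/-- Multiplication by a monomial translates all exponents and respects the term order. -/
theorem isUpperSet_isLead {d m : ℕ} (K : Submodule (DiffPoly d) (Fin m → DiffPoly d))
    (i : Fin m) : IsUpperSet {α | IsLead K i α} := by
  classical
  intro α β hαβ ⟨w, hw, h1, h2⟩
  obtain ⟨γ, rfl⟩ := exists_add_of_le hαβ
  have hco : ∀ j δ, ((MvPolynomial.monomial γ (1 : ℂ) • w) j).coeff δ =
      if γ ≤ δ then (w j).coeff (δ - γ) else 0 := fun j δ => by
    rw [Pi.smul_apply, smul_eq_mul, MvPolynomial.coeff_monomial_mul', one_mul]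
  refine ⟨MvPolynomial.monomial γ 1 • w, K.smul_mem _ hw, ?_, fun δ j hlt => ?_⟩
  · rw [hco, if_pos le_add_self, add_tsub_cancel_right]
    exact h1
  · rw [hco]
    split_ifs with h
    · obtain ⟨δ, rfl⟩ := exists_add_of_le h
      rw [add_tsub_cancel_left]
      refine h2 _ _ ?_
      rw [Prod.Lex.toLex_lt_toLex] at hlt ⊢
      simpa only [add_comm γ δ, toDegLex_add, add_lt_add_iff_right, add_left_inj] using hlt
    · rfl

open scoped Classical in
theorem orderDim_eq_sum_card {d m : ℕ} (K : Submodule (DiffPoly d) (Fin m → DiffPoly d)) (N : ℕ) :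
    orderDim K N = ∑ i, ((multiIndices d N).filter fun α => IsLead K i α).card := by
  let c : Lex (DegLex (Fin d →₀ ℕ) × Fin m) → (Fin m → DiffPoly d) →ₗ[ℂ] ℂ := fun b =>
    MvPolynomial.lcoeff ℂ (ofDegLex (ofLex b).1) ∘ₗ LinearMap.proj (ofLex b).2
  have hcdef : ∀ α i w, c (toLex (toDegLex α, i)) w = (w i).coeff α := fun _ _ _ => rfl
  have hforall : ∀ p : Lex (DegLex (Fin d →₀ ℕ) × Fin m) → Prop,
      (∀ b, p b) ↔ ∀ α i, p (toLex (toDegLex α, i)) := fun p => ⟨fun h _ _ => h _, fun h b => h _ _⟩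
  let e : Fin m × (Fin d →₀ ℕ) ↪ Lex (DegLex (Fin d →₀ ℕ) × Fin m) :=
    ⟨fun x => toLex (toDegLex x.2, x.1), fun x y h => by
      have := toLex.injective h
      rw [Prod.mk.injEq] at this
      exact Prod.ext this.2 (toDegLex.injective this.1)⟩
  let s := ((Finset.univ : Finset (Fin m)) ×ˢ multiIndices d N).map e
  have hs : ∀ α i, toLex (toDegLex α, i) ∈ s ↔ α.degree ≤ N := by
    intro α i
    rw [← mem_multiIndices]
    refine (Finset.mem_map' e (a := (i, α))).trans ?_
    simp
  have hsupp : supportedIn c (K.restrictScalars ℂ) s = K.restrictScalars ℂ ⊓ degLE d m N := by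
    ext w
    rw [mem_supportedIn, Submodule.mem_inf, mem_degLE, hforall]
    simp only [hs, hcdef, not_le]
    rw [forall_comm]
  have h := (finrank_supportedIn_eq_card c (fun w hw => funext fun i => MvPolynomial.ext _ _ fun α =>
    hw (toLex (toDegLex α, i))) (K.restrictScalars ℂ) s).2
  rw [orderDim, ← hsupp, h, Finset.filter_map, Finset.card_map, Finset.card_filter,
    Finset.sum_product]
  refine Finset.sum_congr rfl fun i _ => ?_
  rw [Finset.card_filter]
  refine Finset.sum_congr rfl fun α hα => if_congr ?_ rfl rfl
  rw [mem_multiIndices] at hα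
  simp only [Function.comp_apply]
  change (∃ w ∈ supportedIn c (K.restrictScalars ℂ) s, c (toLex (toDegLex α, i)) w ≠ 0 ∧
    ∀ b' > toLex (toDegLex α, i), c b' w = 0) ↔ _
  constructor
  · rintro ⟨w, hw, h1, h2⟩
    exact ⟨w, hw.1, h1, fun β j hlt => h2 _ hlt⟩
  · rintro ⟨w, hw, h1, h2⟩
    have h2' : ∀ b' > toLex (toDegLex α, i), c b' w = 0 := (hforall _).2 fun β j hlt => h2 β j hlt
    -- The order compares total degrees first, so a leading position of degree at most `N` bounds
    -- the order of the whole element.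
    refine ⟨w, ⟨hw, (hforall _).2 fun β j hβ => h2 β j ?_⟩, h1, h2'⟩
    rw [hs, not_le] at hβ
    rw [Prod.Lex.toLex_lt_toLex]
    refine Or.inl (Finsupp.DegLex.lt_iff.2 (Or.inl ?_))
    exact lt_of_le_of_lt hα hβ

/-! ### Hilbert polynomials -/

/-- The sequence agrees with a polynomial from some index on. -/
def EventuallyPolynomial (f : ℕ → ℝ) : Prop :=
  ∃ p : Polynomial ℝ, ∀ᶠ N : ℕ in atTop, f N = p.eval (N : ℝ)

theorem EventuallyPolynomial.add {f g : ℕ → ℝ} (hf : EventuallyPolynomial f)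
    (hg : EventuallyPolynomial g) : EventuallyPolynomial fun N => f N + g N := by
  obtain ⟨p, hp⟩ := hf
  obtain ⟨q, hq⟩ := hg
  refine ⟨p + q, ?_⟩
  filter_upwards [hp, hq] with N h1 h2
  rw [h1, h2, Polynomial.eval_add]

theorem EventuallyPolynomial.sub {f g : ℕ → ℝ} (hf : EventuallyPolynomial f)
    (hg : EventuallyPolynomial g) : EventuallyPolynomial fun N => f N - g N := by
  obtain ⟨p, hp⟩ := hf
  obtain ⟨q, hq⟩ := hg
  refine ⟨p - q, ?_⟩
  filter_upwards [hp, hq] with N h1 h2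
  rw [h1, h2, Polynomial.eval_sub]

theorem eventuallyPolynomial_zero : EventuallyPolynomial fun _ => 0 :=
  ⟨0, by simp⟩

theorem EventuallyPolynomial.sum {ι : Type*} (s : Finset ι) {f : ι → ℕ → ℝ}
    (hf : ∀ i, EventuallyPolynomial (f i)) : EventuallyPolynomial fun N => ∑ i ∈ s, f i N := by
  classical
  induction s using Finset.induction_on with
  | empty => simpa using eventuallyPolynomial_zero
  | insert a s ha ih =>
    simp only [Finset.sum_insert ha]
    exact (hf a).add ih

theorem card_multiIndices (d N : ℕ) : (multiIndices d N).card = (d + N).choose d := by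
  rw [multiIndices, Finset.card_biUnion]
  · simp only [Finset.card_finsuppAntidiag_nat_eq_multichoose, Finset.card_univ, Fintype.card_fin]
    rw [Nat.sum_range_multichoose N d, add_comm]
  · intro j _ k _ hjk
    refine Finset.disjoint_left.2 fun α hj hk => hjk ?_
    rw [← (Finset.mem_finsuppAntidiag.1 hj).1, ← (Finset.mem_finsuppAntidiag.1 hk).1]

open scoped Classical in
theorem card_filter_le {d N : ℕ} (a : Fin d →₀ ℕ) (h : a.degree ≤ N) :
    ((multiIndices d N).filter fun α => a ≤ α).card = (N - a.degree + d).choose d := by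
  rw [add_comm, ← card_multiIndices]
  refine (Finset.card_bij (fun α _ => a + α) (fun α hα => ?_) (fun α _ β _ h => ?_)
    fun β hβ => ?_).symm
  · rw [mem_multiIndices] at hα
    rw [Finset.mem_filter, mem_multiIndices, map_add]
    exact ⟨by omega, le_self_add⟩
  · exact add_left_cancel h
  · rw [Finset.mem_filter, mem_multiIndices] at hβ
    obtain ⟨γ, rfl⟩ := exists_add_of_le hβ.2
    rw [map_add] at hβ
    exact ⟨γ, by rw [mem_multiIndices]; omega, rfl⟩

open scoped Classical in
-- Inclusion–exclusion: the cone over `a` meets the cone over `b` in the cone over `a ⊔ b`. The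
-- induction is on a bound for the cardinality because forming joins with `a` may identify
-- generators.
theorem eventuallyPolynomial_card_filter_exists_le {d : ℕ} (n : ℕ) :
    ∀ F : Finset (Fin d →₀ ℕ), F.card ≤ n → EventuallyPolynomial fun N =>
      (((multiIndices d N).filter fun α => ∃ a ∈ F, a ≤ α).card : ℝ) := by
  induction n with
  | zero =>
    intro F hF
    rw [Nat.le_zero, Finset.card_eq_zero] at hF
    subst hF
    simpa using eventuallyPolynomial_zero
  | succ n ih =>
    intro F hF
    rcases F.eq_empty_or_nonempty with rfl | ⟨a, ha⟩
    · simpa using eventuallyPolynomial_zero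
    have hcard : (F.erase a).card ≤ n := by rw [Finset.card_erase_of_mem ha]; omega
    have h1 : EventuallyPolynomial fun N =>
        (((multiIndices d N).filter fun α => a ≤ α).card : ℝ) := by
      refine ⟨Polynomial.preHilbertPoly ℝ d a.degree, ?_⟩
      filter_upwards [eventually_ge_atTop a.degree] with N hN
      rw [Polynomial.preHilbertPoly_eq_choose_sub_add ℝ d hN, card_filter_le a hN]
    have h2 := ih (F.erase a) hcard
    have h3 := ih ((F.erase a).image (a ⊔ ·)) (Finset.card_image_le.trans hcard)
    convert (h1.add h2).sub h3 using 2 with N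
    symm
    rw [sub_eq_iff_eq_add]
    norm_cast
    rw [← Finset.card_union_add_card_inter, ← Finset.filter_or, ← Finset.filter_and]
    congr 2
    · refine Finset.filter_congr fun α _ => ?_
      constructor
      · rintro (h | ⟨b, hb, h⟩)
        · exact ⟨a, ha, h⟩
        · exact ⟨b, Finset.mem_of_mem_erase hb, h⟩
      · rintro ⟨b, hb, h⟩
        by_cases hba : b = a
        · exact Or.inl (hba ▸ h)
        · exact Or.inr ⟨b, Finset.mem_erase.2 ⟨hba, hb⟩, h⟩
    · refine Finset.filter_congr fun α _ => ?_
      simp [sup_le_iff]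
      grind

open scoped Classical in
-- Dickson's lemma: an upper set of multi-indices is generated by its finitely many minimal
-- elements.
theorem eventuallyPolynomial_card_of_isUpperSet {d : ℕ} {U : Set (Fin d →₀ ℕ)}
    (hU : IsUpperSet U) : EventuallyPolynomial fun N =>
      (((multiIndices d N).filter fun α => α ∈ U).card : ℝ) := by
  have hpwo := Set.isPWO_of_wellQuasiOrderedLE U
  have hfin : {x | Minimal (· ∈ U) x}.Finite :=
    (setOfPred_minimal_antichain _).finite_of_partiallyWellOrderedOn
      (hpwo.mono (setOfPred_minimal_subset _))
  convert eventuallyPolynomial_card_filter_exists_le _ hfin.toFinset le_rfl using 4 with N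
  refine Finset.filter_congr fun α _ => ?_
  constructor
  · intro hα
    obtain ⟨z, hz, hz'⟩ := hpwo.exists_le_minimal hα
    exact ⟨z, hfin.mem_toFinset.2 hz', hz⟩
  · rintro ⟨a, ha, h⟩
    exact hU h (hfin.mem_toFinset.1 ha).1

theorem eventuallyPolynomial_orderDim {d m : ℕ}
    (K : Submodule (DiffPoly d) (Fin m → DiffPoly d)) :
    EventuallyPolynomial fun N => (orderDim K N : ℝ) := by
  classical
  have : (fun N => (orderDim K N : ℝ)) = fun N => ∑ i,
      (((multiIndices d N).filter fun α => IsLead K i α).card : ℝ) := by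
    funext N
    rw [orderDim_eq_sum_card]
    push_cast
    rfl
  rw [this]
  exact EventuallyPolynomial.sum _ fun i =>
    eventuallyPolynomial_card_of_isUpperSet (isUpperSet_isLead K i)

/-! ### Growth of polynomials under shifts -/

theorem degree_sub_taylor_lt {p : Polynomial ℝ} {k : ℕ} (hp : p.degree < (k + 1 : ℕ)) (r : ℝ) :
    (p - Polynomial.taylor r p).degree < (k : ℕ) := by
  rw [Polynomial.degree_lt_iff_coeff_zero] at hp ⊢
  intro j hj
  have hnat : p.natDegree ≤ k := Polynomial.natDegree_le_iff_coeff_eq_zero.2 fun i hi => hp i hi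
  rw [Polynomial.coeff_sub]
  rcases (hnat.trans hj).eq_or_lt with h | h
  · rw [← h, Polynomial.coeff_taylor_natDegree, Polynomial.leadingCoeff, sub_self]
  · rw [Polynomial.coeff_eq_zero_of_natDegree_lt h, Polynomial.coeff_eq_zero_of_natDegree_lt
      (by rwa [Polynomial.natDegree_taylor]), sub_self]

theorem tendsto_eval_div_pow {p : Polynomial ℝ} {k : ℕ} (hp : p.degree < (k + 1 : ℕ)) :
    Tendsto (fun N : ℕ => p.eval (N : ℝ) / (N : ℝ) ^ k) atTop (𝓝 (p.coeff k)) := by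
  set q := p - Polynomial.C (p.coeff k) * Polynomial.X ^ k with hq
  have hdeg : q.degree < (Polynomial.X ^ k : Polynomial ℝ).degree := by
    rw [Polynomial.degree_X_pow, Polynomial.degree_lt_iff_coeff_zero]
    rw [Polynomial.degree_lt_iff_coeff_zero] at hp
    intro j hj
    rw [hq, Polynomial.coeff_sub, Polynomial.coeff_C_mul_X_pow]
    split_ifs with h
    · rw [h, sub_self]
    · rw [hp j (by omega), sub_zero]
  have h := ((Polynomial.div_tendsto_atTop_zero_of_degree_lt _ _ hdeg).comp
    tendsto_natCast_atTop_atTop).add_const (p.coeff k)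
  rw [zero_add] at h
  refine h.congr' ?_
  filter_upwards [eventually_gt_atTop 0] with N hN
  have hN' : (N : ℝ) ^ k ≠ 0 := pow_ne_zero _ (Nat.cast_ne_zero.2 hN.ne')
  simp only [Function.comp_apply, hq, Polynomial.eval_sub, Polynomial.eval_mul, Polynomial.eval_C,
    Polynomial.eval_pow, Polynomial.eval_X]
  field_simp
  ring

/-- Otherwise `q/p` tends to zero while `p` eventually has no roots, contradicting `|p| ≤ q`. -/
theorem degree_lt_of_eventually_abs_le {p q : Polynomial ℝ} {k : ℕ} (hq : q.degree < (k : ℕ))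
    (h : ∀ᶠ N : ℕ in atTop, |p.eval (N : ℝ)| ≤ q.eval (N : ℝ)) : p.degree < (k : ℕ) := by
  by_contra hk
  rw [not_lt] at hk
  have hlt := hq.trans_le hk
  have hp : p ≠ 0 := by
    rintro rfl
    simp at hk
  have h0 := (Polynomial.div_tendsto_atTop_zero_of_degree_lt _ _ hlt).comp
    (tendsto_natCast_atTop_atTop (R := ℝ))
  have hne := (tendsto_natCast_atTop_atTop (R := ℝ)).eventually
    (Polynomial.eventually_atTop_not_isRoot p hp)
  obtain ⟨N, h1, h2, h3⟩ := ((h0.abs.eventually_lt_const (u := 1) (by rw [abs_zero]; exact one_pos)).and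
    (h.and hne)).exists
  have hpos : 0 < |p.eval (N : ℝ)| := abs_pos.2 h3
  rw [Function.comp_apply, abs_div, div_lt_one hpos] at h1
  exact absurd (h2.trans (le_abs_self _)) (not_le.2 h1)

theorem coeff_le_of_eventually_le_shift {p q : Polynomial ℝ} {k e : ℕ}
    (hp : p.degree < (k + 1 : ℕ)) (hq : q.degree < (k + 1 : ℕ))
    (h : ∀ᶠ N : ℕ in atTop, p.eval (N : ℝ) ≤ q.eval ((N + e : ℕ) : ℝ)) :
    p.coeff k ≤ q.coeff k := by
  have hq' : (Polynomial.taylor (e : ℝ) q).degree < (k + 1 : ℕ) := by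
    rwa [Polynomial.degree_taylor]
  have hc : (Polynomial.taylor (e : ℝ) q).coeff k = q.coeff k := by
    have := (Polynomial.degree_lt_iff_coeff_zero _ _).1 (degree_sub_taylor_lt hq (e : ℝ)) k le_rfl
    rw [Polynomial.coeff_sub, sub_eq_zero] at this
    exact this.symm
  rw [← hc]
  refine le_of_tendsto_of_tendsto (tendsto_eval_div_pow hp) (tendsto_eval_div_pow hq') ?_
  filter_upwards [h] with N hN
  rw [Polynomial.taylor_eval]
  push_cast at hN
  gcongr

/-! ### Module maps and the order filtration -/

theorem mem_degLE_iff_totalDegree {d m N : ℕ} {q : Fin m → DiffPoly d} :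
    q ∈ degLE d m N ↔ ∀ i, (q i).totalDegree ≤ N := by
  rw [mem_degLE]
  refine forall_congr' fun i => ⟨fun h => ?_, fun h α hα => ?_⟩
  · refine Finset.sup_le fun α hα => ?_
    by_contra hlt
    exact MvPolynomial.mem_support_iff.1 hα (h α (not_le.1 hlt))
  · exact MvPolynomial.coeff_eq_zero_of_totalDegree_lt (h.trans_lt hα)

theorem exists_order_bound {d m m' : ℕ}
    (L : (Fin m → DiffPoly d) →ₗ[DiffPoly d] (Fin m' → DiffPoly d)) :
    ∃ e, ∀ N, ∀ q ∈ degLE d m N, L q ∈ degLE d m' (N + e) := by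
  refine ⟨∑ i, ∑ j, (L (Pi.single i 1) j).totalDegree, fun N q hq => ?_⟩
  rw [mem_degLE_iff_totalDegree] at hq ⊢
  intro j
  have : L q j = ∑ i, q i * L (Pi.single i 1) j := by
    conv_lhs => rw [pi_eq_sum_univ' q]
    simp only [map_sum, map_smul, Finset.sum_apply, Pi.smul_apply, smul_eq_mul]
  rw [this]
  refine MvPolynomial.totalDegree_finsetSum_le fun i _ =>
    (MvPolynomial.totalDegree_mul _ _).trans (add_le_add (hq i) ?_)
  exact (Finset.single_le_sum (f := fun j => (L (Pi.single i 1) j).totalDegree)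
    (fun _ _ => Nat.zero_le _) (Finset.mem_univ j)).trans
    (Finset.single_le_sum (f := fun i => ∑ j, (L (Pi.single i 1) j).totalDegree)
    (fun _ _ => Nat.zero_le _) (Finset.mem_univ i))

instance finite_degLE (d m N : ℕ) : Module.Finite ℂ (degLE d m N) := by
  rw [← range_ofCoeffs]
  infer_instance

instance finite_inf_degLE {d m N : ℕ} (V : Submodule ℂ (Fin m → DiffPoly d)) :
    Module.Finite ℂ ↥(V ⊓ degLE d m N) :=
  Submodule.finiteDimensional_of_le inf_le_right

/-- Modulo `B'`, the image of `A` lies in that of `A'`, and the kernel on `A` lies in `B`;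
rank-nullity for both maps gives the inequality. -/
theorem finrank_add_le_of_map {k W W' : Type*} [Field k] [AddCommGroup W] [Module k W]
    [AddCommGroup W'] [Module k W'] (L : W →ₗ[k] W') {A B : Submodule k W} {A' B' : Submodule k W'}
    [Module.Finite k A] [Module.Finite k B] [Module.Finite k A'] (hL : ∀ a ∈ A, L a ∈ A')
    (hB' : B' ≤ A') (hB : ∀ a ∈ A, L a ∈ B' → a ∈ B) :
    Module.finrank k A + Module.finrank k B' ≤ Module.finrank k B + Module.finrank k A' := by
  let f : A →ₗ[k] W' ⧸ B' := B'.mkQ ∘ₗ L ∘ₗ A.subtype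
  let g : A' →ₗ[k] W' ⧸ B' := B'.mkQ ∘ₗ A'.subtype
  have hf := f.finrank_range_add_finrank_ker
  have hg := g.finrank_range_add_finrank_ker
  have h1 : Module.finrank k (LinearMap.range f) ≤ Module.finrank k (LinearMap.range g) := by
    refine Submodule.finrank_mono ?_
    rintro _ ⟨a, rfl⟩
    exact ⟨⟨L a, hL a a.2⟩, rfl⟩
  have h2 : Module.finrank k (LinearMap.ker f) ≤ Module.finrank k B := by
    rw [LinearEquiv.finrank_eq (Submodule.equivMapOfInjective _ A.injective_subtype (LinearMap.ker f))]
    refine Submodule.finrank_mono ?_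
    rintro _ ⟨a, ha, rfl⟩
    exact hB a a.2 ((Submodule.Quotient.mk_eq_zero B').1 ha)
  have h3 : Module.finrank k (LinearMap.ker g) = Module.finrank k B' := by
    have : (LinearMap.ker g).map A'.subtype = B' := by
      ext w
      constructor
      · rintro ⟨a, ha, rfl⟩
        exact (Submodule.Quotient.mk_eq_zero B').1 ha
      · intro hw
        exact ⟨⟨w, hB' hw⟩, (Submodule.Quotient.mk_eq_zero B').2 hw, rfl⟩
    conv_rhs => rw [← this]
    exact LinearEquiv.finrank_eq (Submodule.equivMapOfInjective _ A'.injective_subtype _)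
  omega

/-! ### Torsion and its growth -/

/-- Over the fraction field, a covector vanishing on the kernel of `T` is a combination of its rows.
Denominators are cleared twice: in a kernel vector, to test it against `q`, and in the coefficients,
to obtain `f`. -/
theorem exists_ne_zero_smul_mem_rowModule_of_mem {d n m : ℕ}
    {T : Matrix (Fin n) (Fin m) (DiffPoly d)} {q : Fin m → DiffPoly d} (hq : q ∈ rowClosure T) :
    ∃ f : DiffPoly d, f ≠ 0 ∧ f • q ∈ rowModule T := by
  let F := FractionRing (DiffPoly d)
  let ι := algebraMap (DiffPoly d) F
  have hι : Function.Injective ι := IsFractionRing.injective (DiffPoly d) F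
  let L : Fin n → (Fin m → F) →ₗ[F] F := fun a => Fintype.linearCombination F (fun i => ι (T a i))
  let Q : (Fin m → F) →ₗ[F] F := Fintype.linearCombination F (fun i => ι (q i))
  have hker : (⨅ a, LinearMap.ker (L a)) ≤ LinearMap.ker Q := by
    intro R hR
    obtain ⟨b, hb⟩ := IsLocalization.exist_integer_multiples_of_finite
      (nonZeroDivisors (DiffPoly d)) R
    choose r hr using hb
    have hb0 : ι b ≠ 0 := (map_ne_zero_iff ι hι).2 (nonZeroDivisors.coe_ne_zero b)
    have hlin : ∀ v : Fin m → DiffPoly d, ι (v ⬝ᵥ r) =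
        ι b * Fintype.linearCombination F (fun i => ι (v i)) R := by
      intro v
      simp only [dotProduct, map_sum, map_mul, Fintype.linearCombination_apply, Finset.mul_sum,
        smul_eq_mul]
      refine Finset.sum_congr rfl fun i _ => ?_
      rw [show ι (r i) = ι b * R i from (hr i).trans (Algebra.smul_def _ _)]
      ring
    have hTr : T.mulVec r = 0 := by
      funext a
      refine hι ?_
      change ι (T a ⬝ᵥ r) = ι 0
      rw [hlin, map_zero]
      have := (Submodule.mem_iInf _).1 hR a
      rw [show Fintype.linearCombination F (fun i => ι (T a i)) R = 0 from this, mul_zero]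
    have h0 := hlin q
    rw [hq r hTr, map_zero] at h0
    exact (mul_eq_zero.1 h0.symm).resolve_left hb0
  obtain ⟨c, hc⟩ := (Submodule.mem_span_range_iff_exists_fun F).1
    (mem_span_of_iInf_ker_le_ker hker)
  obtain ⟨b, hb⟩ := IsLocalization.exist_integer_multiples_of_finite
    (nonZeroDivisors (DiffPoly d)) c
  choose r hr using hb
  refine ⟨b, nonZeroDivisors.coe_ne_zero b, r, funext fun i => hι ?_⟩
  have hi : ∑ a, c a * ι (T a i) = ι (q i) := by
    have := LinearMap.congr_fun hc (Pi.single i 1)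
    simpa [L, Q, Fintype.linearCombination_apply, Pi.single_apply] using this
  rw [Matrix.vecMulLinear_apply, Pi.smul_apply, smul_eq_mul, map_mul, ← hi, Finset.mul_sum]
  simp only [Matrix.vecMul, dotProduct, map_sum, map_mul]
  refine Finset.sum_congr rfl fun a _ => ?_
  rw [show ι (r a) = ι b * c a from (hr a).trans (Algebra.smul_def _ _), mul_assoc]

theorem exists_ne_zero_smul_mem_rowModule {d n m : ℕ} (T : Matrix (Fin n) (Fin m) (DiffPoly d)) :
    ∃ f : DiffPoly d, f ≠ 0 ∧ ∀ q ∈ rowClosure T, f • q ∈ rowModule T := by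
  obtain ⟨S, hS⟩ := IsNoetherian.noetherian (rowClosure T)
  have h : ∀ q : S, ∃ f : DiffPoly d, f ≠ 0 ∧ f • (q : Fin m → DiffPoly d) ∈ rowModule T :=
    fun q => exists_ne_zero_smul_mem_rowModule_of_mem (hS ▸ Submodule.subset_span q.2)
  choose f hf hmem using h
  refine ⟨∏ q, f q, Finset.prod_ne_zero_iff.2 fun q _ => hf q, fun q hq => ?_⟩
  have hle : Submodule.span (DiffPoly d) (S : Set (Fin m → DiffPoly d)) ≤
      (rowModule T).comap (LinearMap.lsmul (DiffPoly d) (Fin m → DiffPoly d) (∏ q, f q)) := by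
    refine Submodule.span_le.2 fun s hs => ?_
    obtain ⟨c, hc⟩ := Finset.dvd_prod_of_mem f (Finset.mem_univ (⟨s, hs⟩ : S))
    change (∏ q, f q) • s ∈ rowModule T
    rw [hc, mul_comm, mul_smul]
    exact Submodule.smul_mem _ _ (hmem ⟨s, hs⟩)
  exact hle (hS.symm ▸ hq)

/-- The dimension of the elements of order at most `N` in the torsion submodule of the module
presented by `T`. -/
def torsionDim {d n m : ℕ} (T : Matrix (Fin n) (Fin m) (DiffPoly d)) (N : ℕ) : ℝ :=
  (orderDim (rowClosure T) N : ℝ) - orderDim (rowModule T) N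

theorem torsionDim_nonneg {d n m : ℕ} (T : Matrix (Fin n) (Fin m) (DiffPoly d)) (N : ℕ) :
    0 ≤ torsionDim T N := by
  rw [torsionDim, sub_nonneg]
  exact Nat.cast_le.2 (Submodule.finrank_mono (s := (rowModule T).restrictScalars ℂ ⊓ degLE d m N)
    (t := (rowClosure T).restrictScalars ℂ ⊓ degLE d m N)
    (inf_le_inf_right _ (rowModule_le_rowClosure T)))

theorem torsionDim_eq_finrank_sub {d n m : ℕ} (T : Matrix (Fin n) (Fin m) (DiffPoly d)) (N : ℕ) :
    torsionDim T N = (Module.finrank ℂ ((solutions T).map (taylorProj m N)) : ℝ) -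
      Module.finrank ℂ ((trivialSolutions T).map (taylorProj m N)) := by
  have h1 := finrank_map_taylorProj_add_orderDim (fun _ => mem_rowModule_iff_pairing (T := T)) N
  have h2 := finrank_map_taylorProj_add_orderDim (fun _ => mem_rowClosure_iff_pairing (T := T)) N
  have h3 := (h1.trans h2.symm)
  rify at h3
  rw [torsionDim]
  linarith

/-- Multiplication by the operator `f` killing the torsion is injective and sends the row closure
into the row module, raising orders by at most `e`. -/
theorem exists_torsionDim_le_orderDim_sub {d n m : ℕ} (T : Matrix (Fin n) (Fin m) (DiffPoly d)) :
    ∃ e, ∀ N, torsionDim T N ≤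
      (orderDim (rowModule T) (N + e) : ℝ) - orderDim (rowModule T) N := by
  obtain ⟨f, hf, hmem⟩ := exists_ne_zero_smul_mem_rowModule T
  let L := LinearMap.lsmul (DiffPoly d) (Fin m → DiffPoly d) f
  obtain ⟨e, he⟩ := exists_order_bound L
  refine ⟨e, fun N => ?_⟩
  have h := finrank_add_le_of_map (L.restrictScalars ℂ)
    (A := (rowClosure T).restrictScalars ℂ ⊓ degLE d m N) (B := ⊥)
    (A' := (rowModule T).restrictScalars ℂ ⊓ degLE d m (N + e)) (B' := ⊥)
    (fun q hq => ⟨hmem q hq.1, he N q hq.2⟩) bot_le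
    (fun q _ hq => (smul_eq_zero.1 (show f • q = 0 from hq)).resolve_left hf)
  simp only [finrank_bot, add_zero, zero_add] at h
  rw [torsionDim]
  refine sub_le_sub_right ?_ _
  exact_mod_cast h

theorem exists_polynomial_orderDim {d m : ℕ} (K : Submodule (DiffPoly d) (Fin m → DiffPoly d)) :
    ∃ p : Polynomial ℝ, p.degree < (d + 1 : ℕ) ∧
      ∀ᶠ N : ℕ in atTop, (orderDim K N : ℝ) = p.eval (N : ℝ) := by
  classical
  obtain ⟨p, hp⟩ := eventuallyPolynomial_orderDim K
  refine ⟨p, degree_lt_of_eventually_abs_le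
    (q := Polynomial.C (m : ℝ) * Polynomial.preHilbertPoly ℝ d 0) ?_ ?_, hp⟩
  · refine lt_of_le_of_lt Polynomial.degree_le_natDegree ?_
    exact_mod_cast Nat.lt_succ_of_le ((Polynomial.natDegree_C_mul_le _ _).trans
      (Polynomial.natDegree_preHilbertPoly ℝ d 0).le)
  · filter_upwards [hp] with N hN
    rw [← hN, Nat.abs_cast, Polynomial.eval_mul, Polynomial.eval_C,
      Polynomial.preHilbertPoly_eq_choose_sub_add ℝ d (Nat.zero_le N), orderDim_eq_sum_card]
    norm_cast
    rw [Nat.sub_zero, add_comm N d, ← card_multiIndices]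
    refine (Finset.sum_le_card_nsmul _ _ _ fun i _ => Finset.card_filter_le _ _).trans ?_
    simp

theorem exists_polynomial_torsionDim {d n m : ℕ}
    (T : Matrix (Fin n) (Fin m) (DiffPoly d)) :
    ∃ p : Polynomial ℝ, p.degree < (d : ℕ) ∧
      ∀ᶠ N : ℕ in atTop, torsionDim T N = p.eval (N : ℝ) := by
  obtain ⟨p, hpd, hp⟩ := exists_polynomial_orderDim (rowModule T)
  obtain ⟨q, -, hq⟩ := exists_polynomial_orderDim (rowClosure T)
  obtain ⟨e, he⟩ := exists_torsionDim_le_orderDim_sub T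
  have heq : ∀ᶠ N : ℕ in atTop, torsionDim T N = (q - p).eval (N : ℝ) := by
    filter_upwards [hp, hq] with N h1 h2
    rw [torsionDim, h1, h2, Polynomial.eval_sub]
  refine ⟨q - p, degree_lt_of_eventually_abs_le
    (q := -(p - Polynomial.taylor (e : ℝ) p)) ?_ ?_, heq⟩
  · rw [Polynomial.degree_neg]
    exact degree_sub_taylor_lt hpd _
  · filter_upwards [heq, hp, (tendsto_add_atTop_nat e).eventually hp] with N h1 h2 h3
    rw [← h1, abs_of_nonneg (torsionDim_nonneg T N), neg_sub, Polynomial.eval_sub,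
      Polynomial.taylor_eval, ← h2]
    push_cast at h3
    rw [← h3]
    exact he N

/-! ### The limit and its comparison between systems -/

/-- Here `taylor (-1) p` is `N ↦ p(N - 1)`, so the numerator is eventually `N (p(N) - p(N-1))`, of
degree at most `d - 1`. The binomial has degree `d - 1` and leading coefficient `1/(d-1)!`. -/
theorem isDegreeOfFreedom_of_torsionDim {d n m : ℕ} (hd : 2 ≤ d)
    {T : Matrix (Fin n) (Fin m) (DiffPoly d)} {p : Polynomial ℝ} (hdeg : p.degree < (d : ℕ))
    (hp : ∀ᶠ N : ℕ in atTop, torsionDim T N = p.eval (N : ℝ)) :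
    IsDegreeOfFreedom T (1 / ((d : ℝ) - 1) *
      ((Polynomial.X * (p - Polynomial.taylor (-1) p)).coeff (d - 1) * (d - 1).factorial)) := by
  obtain ⟨k, rfl⟩ : ∃ k, d = k + 2 := ⟨d - 2, by omega⟩
  set Q := Polynomial.X * (p - Polynomial.taylor (-1) p)
  have hQ : Q.degree < (k + 1 + 1 : ℕ) := by
    have h := degree_sub_taylor_lt (k := k + 1) hdeg (-1)
    rw [Polynomial.degree_lt_iff_coeff_zero] at h ⊢
    intro j hj
    obtain ⟨j, rfl⟩ : ∃ i, j = i + 1 := ⟨j - 1, by omega⟩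
    rw [Polynomial.coeff_X_mul]
    exact h j (by omega)
  have hH : (Polynomial.preHilbertPoly ℝ (k + 1) 0).degree < (k + 1 + 1 : ℕ) := by
    refine lt_of_le_of_lt Polynomial.degree_le_natDegree ?_
    rw [Polynomial.natDegree_preHilbertPoly]
    exact_mod_cast Nat.lt_succ_self _
  have hfac : ((k + 1).factorial : ℝ)⁻¹ ≠ 0 := inv_ne_zero (Nat.cast_ne_zero.2 (Nat.factorial_ne_zero _))
  have hlim := (tendsto_eval_div_pow hQ).div (tendsto_eval_div_pow hH)
    (by rwa [Polynomial.coeff_preHilbertPoly_self])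
  rw [Polynomial.coeff_preHilbertPoly_self, div_inv_eq_mul] at hlim
  refine Tendsto.const_mul _ (hlim.congr' ?_)
  have hp1 : ∀ᶠ N : ℕ in atTop, torsionDim T (N - 1) = p.eval ((N - 1 : ℕ) : ℝ) :=
    (tendsto_sub_atTop_nat 1).eventually hp
  filter_upwards [hp, hp1, eventually_gt_atTop 0] with N h1 h2 hN
  obtain ⟨N, rfl⟩ : ∃ i, N = i + 1 := ⟨N - 1, by omega⟩
  rw [Nat.add_sub_cancel] at h2
  have hdiff : ((hilbertFun (solutions T) (N + 1) : ℤ) : ℝ) -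
      (hilbertFun (trivialSolutions T) (N + 1) : ℤ) = torsionDim T (N + 1) - torsionDim T N := by
    simp only [hilbertFun, torsionDim_eq_finrank_sub]
    push_cast
    ring
  have hchoose : (((N + 1) + (k + 2) - 1).choose (N + 1) : ℝ) =
      (Polynomial.preHilbertPoly ℝ (k + 1) 0).eval ((N + 1 : ℕ) : ℝ) := by
    rw [Polynomial.preHilbertPoly_eq_choose_sub_add ℝ (k + 1) (Nat.zero_le _), Nat.sub_zero,
      show N + 1 + (k + 2) - 1 = (N + 1) + (k + 1) by omega, Nat.choose_symm_add]
  have hQe : Q.eval ((N + 1 : ℕ) : ℝ) = (N + 1 : ℕ) * (torsionDim T (N + 1) - torsionDim T N) := by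
    rw [Polynomial.eval_mul, Polynomial.eval_X, Polynomial.eval_sub, Polynomial.taylor_eval, h1, h2]
    congr 3
    push_cast
    ring
  have hpow : ((N + 1 : ℕ) : ℝ) ^ (k + 1) ≠ 0 := pow_ne_zero _ (Nat.cast_ne_zero.2 (by omega))
  simp only [Pi.div_apply]
  rw [hdiff, hchoose, ← hQe, div_div_div_cancel_right₀ hpow]

theorem sameDegreeOfFreedom_of_torsionDim_le {d n m n' m' : ℕ} (hd : 2 ≤ d)
    {T : Matrix (Fin n) (Fin m) (DiffPoly d)} {T' : Matrix (Fin n') (Fin m') (DiffPoly d)} {e e' : ℕ}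
    (h : ∀ N, torsionDim T N ≤ torsionDim T' (N + e))
    (h' : ∀ N, torsionDim T' N ≤ torsionDim T (N + e')) : SameDegreeOfFreedom T T' := by
  obtain ⟨p, hpd, hp⟩ := exists_polynomial_torsionDim T
  obtain ⟨p', hpd', hp'⟩ := exists_polynomial_torsionDim T'
  obtain ⟨k, rfl⟩ : ∃ k, d = k + 2 := ⟨d - 2, by omega⟩
  -- Only this coefficient matters: lower terms disappear from degree `d - 1` after differencing and
  -- multiplying by `N`.
  have hc : p.coeff (k + 1) = p'.coeff (k + 1) := by
    refine le_antisymm (coeff_le_of_eventually_le_shift (e := e) hpd hpd' ?_)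
      (coeff_le_of_eventually_le_shift (e := e') hpd' hpd ?_)
    · filter_upwards [hp, (tendsto_add_atTop_nat e).eventually hp'] with N h1 h2
      rw [← h1, ← h2]
      exact h N
    · filter_upwards [hp', (tendsto_add_atTop_nat e').eventually hp] with N h1 h2
      rw [← h1, ← h2]
      exact h' N
  have hsub : (p - p').degree < (k + 1 : ℕ) := by
    rw [Polynomial.degree_lt_iff_coeff_zero] at hpd hpd' ⊢
    intro j hj
    rw [Polynomial.coeff_sub]
    rcases hj.eq_or_lt with rfl | hj
    · rw [hc, sub_self]
    · rw [hpd j hj, hpd' j hj, sub_self]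
  have hcoef : (Polynomial.X * (p - Polynomial.taylor (-1) p)).coeff (k + 1) =
      (Polynomial.X * (p' - Polynomial.taylor (-1) p')).coeff (k + 1) := by
    rw [← sub_eq_zero, ← Polynomial.coeff_sub, ← mul_sub, Polynomial.coeff_X_mul,
      sub_sub_sub_comm, ← map_sub]
    exact (Polynomial.degree_lt_iff_coeff_zero _ _).1 (degree_sub_taylor_lt hsub (-1)) k le_rfl
  refine ⟨_, isDegreeOfFreedom_of_torsionDim hd hpd hp, ?_⟩
  have := isDegreeOfFreedom_of_torsionDim hd hpd' hp'
  rwa [show k + 2 - 1 = k + 1 from rfl, ← hcoef] at this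

/-- The hypotheses say that `L` induces an injection of torsion modules; `e` bounds how far it
raises orders. -/
theorem exists_torsionDim_le {d n m n' m' : ℕ} {T : Matrix (Fin n) (Fin m) (DiffPoly d)}
    {T' : Matrix (Fin n') (Fin m') (DiffPoly d)}
    (L : (Fin m → DiffPoly d) →ₗ[DiffPoly d] (Fin m' → DiffPoly d))
    (hL : ∀ q ∈ rowClosure T, L q ∈ rowClosure T')
    (hL' : ∀ q ∈ rowClosure T, L q ∈ rowModule T' → q ∈ rowModule T) :
    ∃ e, ∀ N, torsionDim T N ≤ torsionDim T' (N + e) := by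
  obtain ⟨e, he⟩ := exists_order_bound L
  refine ⟨e, fun N => ?_⟩
  have h := finrank_add_le_of_map (L.restrictScalars ℂ)
    (A := (rowClosure T).restrictScalars ℂ ⊓ degLE d m N)
    (B := (rowModule T).restrictScalars ℂ ⊓ degLE d m N)
    (A' := (rowClosure T').restrictScalars ℂ ⊓ degLE d m' (N + e))
    (B' := (rowModule T').restrictScalars ℂ ⊓ degLE d m' (N + e))
    (fun q hq => ⟨hL q hq.1, he N q hq.2⟩) (inf_le_inf_right _ (rowModule_le_rowClosure T'))
    (fun q hq hq' => ⟨hL' q hq.1 hq'.1, hq.2⟩)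
  have h' : (orderDim (rowClosure T) N : ℝ) + orderDim (rowModule T') (N + e) ≤
      orderDim (rowModule T) N + orderDim (rowClosure T') (N + e) := by exact_mod_cast h
  rw [torsionDim, torsionDim]
  linarith

/-! ### Invariance under equivalence -/

theorem Equivalent.symm {d n n' m : ℕ} {T : Matrix (Fin n) (Fin m) (DiffPoly d)}
    {T' : Matrix (Fin n') (Fin m) (DiffPoly d)} (h : Equivalent T T') : Equivalent T' T :=
  ⟨h.2, h.1⟩

theorem Equivalent.map {d n n' m : ℕ} {T : Matrix (Fin n) (Fin m) (DiffPoly d)}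
    {T' : Matrix (Fin n') (Fin m) (DiffPoly d)} (h : Equivalent T T')
    (σ : DiffPoly d →+* DiffPoly d) : Equivalent (T.map σ) (T'.map σ) := by
  obtain ⟨⟨D, rfl⟩, D', hD'⟩ := h
  exact ⟨⟨D.map σ, (Matrix.map_mul).symm⟩, D'.map σ, by rw [← Matrix.map_mul, hD']⟩

theorem rowModule_le_of_mul_eq {d n n' m : ℕ} {T : Matrix (Fin n) (Fin m) (DiffPoly d)}
    {T' : Matrix (Fin n') (Fin m) (DiffPoly d)} {D : Matrix (Fin n') (Fin n) (DiffPoly d)}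
    (h : D * T = T') : rowModule T' ≤ rowModule T := by
  rintro _ ⟨c, rfl⟩
  exact ⟨Matrix.vecMul c D, by simp [← h, Matrix.vecMul_vecMul]⟩

theorem rowClosure_le_of_mul_eq {d n n' m : ℕ} {T : Matrix (Fin n) (Fin m) (DiffPoly d)}
    {T' : Matrix (Fin n') (Fin m) (DiffPoly d)} {D : Matrix (Fin n') (Fin n) (DiffPoly d)}
    (h : D * T = T') : rowClosure T' ≤ rowClosure T := fun q hq R hR =>
  hq R (by rw [← h, ← Matrix.mulVec_mulVec, hR, Matrix.mulVec_zero])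

theorem Equivalent.sameDegreeOfFreedom {d n n' m : ℕ} (hd : 2 ≤ d)
    {T : Matrix (Fin n) (Fin m) (DiffPoly d)} {T' : Matrix (Fin n') (Fin m) (DiffPoly d)}
    (h : Equivalent T T') : SameDegreeOfFreedom T T' := by
  obtain ⟨⟨D, hD⟩, D', hD'⟩ := h
  have heq : ∀ N, torsionDim T N = torsionDim T' N := fun N => by
    rw [torsionDim, torsionDim,
      le_antisymm (rowModule_le_of_mul_eq hD') (rowModule_le_of_mul_eq hD),
      le_antisymm (rowClosure_le_of_mul_eq hD') (rowClosure_le_of_mul_eq hD)]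
  exact sameDegreeOfFreedom_of_torsionDim_le hd (e := 0) (e' := 0) (fun N => (heq N).le)
    (fun N => (heq N).ge)

/-- Although `D' * D` need not be the identity, `(D' * D - 1) * T = 0`, so its rows are gauge
generators of the transpose. Elements of the row closure are orthogonal to them, hence fixed by `D'
* D`, which makes `D` injective on torsion. -/
theorem Equivalent.exists_torsionDim_transpose_le {d n n' m : ℕ}
    {T : Matrix (Fin n) (Fin m) (DiffPoly d)} {T' : Matrix (Fin n') (Fin m) (DiffPoly d)}
    (h : Equivalent T T') : ∃ e, ∀ N, torsionDim T.transpose N ≤ torsionDim T'.transpose (N + e) := by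
  obtain ⟨⟨D, hD⟩, D', hD'⟩ := h
  refine exists_torsionDim_le D.mulVecLin (fun q hq R hR => ?_) (fun q hq hq' => ?_)
  · rw [Matrix.mulVecLin_apply, ← Matrix.vecMul_transpose, ← Matrix.dotProduct_mulVec]
    refine hq _ ?_
    rw [Matrix.mulVec_mulVec, ← Matrix.transpose_mul, hD, hR]
  · have hfix : D'.mulVec (D.mulVec q) = q := by
      funext a
      let E : Matrix (Fin n) (Fin n) (DiffPoly d) := D' * D - 1
      have hE : E * T = 0 := by
        rw [Matrix.sub_mul, Matrix.mul_assoc, hD, hD', Matrix.one_mul, sub_self]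
      have hrow : T.transpose.mulVec (E a) = 0 := by
        rw [Matrix.mulVec_transpose]
        exact congr_fun hE a
      have := hq _ hrow
      rw [dotProduct_comm] at this
      change ((D' * D - 1 : Matrix (Fin n) (Fin n) (DiffPoly d)).mulVec q) a = 0 at this
      rw [Matrix.sub_mulVec, Matrix.one_mulVec, Pi.sub_apply, sub_eq_zero] at this
      rw [Matrix.mulVec_mulVec, this]
    obtain ⟨c, hc⟩ := hq'
    refine ⟨c, ?_⟩
    rw [Matrix.vecMulLinear_apply, Matrix.vecMul_transpose, Matrix.mulVecLin_apply] at hc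
    rw [Matrix.vecMulLinear_apply, Matrix.vecMul_transpose, ← hfix, ← hc, Matrix.mulVec_mulVec, hD']

theorem Equivalent.sameDegreeOfFreedom_transpose {d n n' m : ℕ} (hd : 2 ≤ d)
    {T : Matrix (Fin n) (Fin m) (DiffPoly d)} {T' : Matrix (Fin n') (Fin m) (DiffPoly d)}
    (h : Equivalent T T') : SameDegreeOfFreedom T.transpose T'.transpose := by
  obtain ⟨e, he⟩ := h.exists_torsionDim_transpose_le
  obtain ⟨e', he'⟩ := h.symm.exists_torsionDim_transpose_le
  exact sameDegreeOfFreedom_of_torsionDim_le hd he he'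

/-! ### Conjugates and chains of equivalences -/

/-- The substitution `∂ ↦ -∂`. -/
def reflection (d : ℕ) : DiffPoly d →+* DiffPoly d :=
  (MvPolynomial.aeval fun μ => -MvPolynomial.X μ : DiffPoly d →ₐ[ℂ] DiffPoly d)

theorem reflection_reflection {d : ℕ} (p : DiffPoly d) : reflection d (reflection d p) = p := by
  have : ((MvPolynomial.aeval fun μ => -MvPolynomial.X μ : DiffPoly d →ₐ[ℂ] DiffPoly d).comp
      (MvPolynomial.aeval fun μ => -MvPolynomial.X μ)) = AlgHom.id ℂ _ := by
    ext μ; simp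
  exact AlgHom.congr_fun this p

theorem conjugate_conjugate {d n m : ℕ} (T : Matrix (Fin n) (Fin m) (DiffPoly d)) :
    conjugate (conjugate T) = T := by
  ext1 i a
  exact reflection_reflection _

theorem transpose_eq_map_conjugate {d n m : ℕ} (T : Matrix (Fin n) (Fin m) (DiffPoly d)) :
    T.transpose = (conjugate T).map (reflection d) := by
  ext1 i a
  exact (reflection_reflection _).symm

/-- The degrees of freedom of two systems, of their conjugates and of their transposes are well
defined and equal. -/
def SameDegreesOfFreedom {d : ℕ} (S S' : System d) : Prop :=
  SameDegreeOfFreedom S.matrix S'.matrix ∧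
    SameDegreeOfFreedom (conjugate S.matrix) (conjugate S'.matrix) ∧
    SameDegreeOfFreedom S.matrix.transpose S'.matrix.transpose

theorem SameDegreeOfFreedom.trans {d n m n' m' n'' m'' : ℕ}
    {T : Matrix (Fin n) (Fin m) (DiffPoly d)} {T' : Matrix (Fin n') (Fin m') (DiffPoly d)}
    {T'' : Matrix (Fin n'') (Fin m'') (DiffPoly d)} (h : SameDegreeOfFreedom T T')
    (h' : SameDegreeOfFreedom T' T'') : SameDegreeOfFreedom T T'' := by
  obtain ⟨c, h1, h2⟩ := h
  obtain ⟨c', h3, h4⟩ := h'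
  obtain rfl := tendsto_nhds_unique h2 h3
  exact ⟨c, h1, h4⟩

theorem Equivalent.refl {d n m : ℕ} (T : Matrix (Fin n) (Fin m) (DiffPoly d)) : Equivalent T T :=
  ⟨⟨1, Matrix.one_mul T⟩, 1, Matrix.one_mul T⟩

theorem Equivalent.sameDegreesOfFreedom {d n n' m : ℕ} (hd : 2 ≤ d)
    {T : Matrix (Fin n) (Fin m) (DiffPoly d)} {T' : Matrix (Fin n') (Fin m) (DiffPoly d)}
    (h : Equivalent T T') : SameDegreesOfFreedom ⟨n, m, T⟩ ⟨n', m, T'⟩ :=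
  -- The conjugate is definitionally the transpose of the reflected matrix.
  ⟨h.sameDegreeOfFreedom hd, (h.map (reflection d)).sameDegreeOfFreedom_transpose hd,
    h.sameDegreeOfFreedom_transpose hd⟩

theorem ElementaryEquivalent.sameDegreesOfFreedom {d : ℕ} (hd : 2 ≤ d) {S S' : System d}
    (h : ElementaryEquivalent S S') : SameDegreesOfFreedom S S' := by
  cases h with
  | of_equivalent T T' h => exact h.sameDegreesOfFreedom hd
  | of_conjugate T T' h =>
    obtain ⟨h1, h2, -⟩ := h.sameDegreesOfFreedom hd
    have h3 := (h.map (reflection d)).sameDegreeOfFreedom hd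
    rw [← transpose_eq_map_conjugate, ← transpose_eq_map_conjugate] at h3
    simp only [conjugate_conjugate] at h2
    -- Conjugation is an involution, so the assertions about a system and its conjugate trade
    -- places; the transposes are the reflected conjugates.
    exact ⟨h2, h1, h3⟩

theorem WeaklyEquivalent.sameDegreesOfFreedom {d : ℕ} (hd : 2 ≤ d) {S S' : System d}
    (h : WeaklyEquivalent S S') : SameDegreesOfFreedom S S' := by
  induction h with
  -- Even the trivial chain asserts that the limits exist.
  | refl => exact (Equivalent.refl S.matrix).sameDegreesOfFreedom hd
  | tail _ h ih =>
    obtain ⟨h1, h2, h3⟩ := h.sameDegreesOfFreedom hd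
    exact ⟨ih.1.trans h1, ih.2.1.trans h2, ih.2.2.trans h3⟩

end LinearPDE

end

theorem mainTheorem9 (d : ℕ) (hd : 2 ≤ d) :
    (∀ (n n' m : ℕ) (T : Matrix (Fin n) (Fin m) (DiffPoly d))
      (T' : Matrix (Fin n') (Fin m) (DiffPoly d)), Equivalent T T' →
        SameDegreeOfFreedom T T' ∧
        SameDegreeOfFreedom (conjugate T) (conjugate T') ∧
        SameDegreeOfFreedom T.transpose T'.transpose) ∧
    (∀ S S' : System d, WeaklyEquivalent S S' →
        SameDegreeOfFreedom S.matrix S'.matrix ∧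
        SameDegreeOfFreedom (conjugate S.matrix) (conjugate S'.matrix) ∧
        SameDegreeOfFreedom S.matrix.transpose S'.matrix.transpose) := by
  exact ⟨fun _ _ _ _ _ h => h.sameDegreesOfFreedom hd, fun _ _ h => h.sameDegreesOfFreedom hd⟩
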